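/- A complete or incomplete first-order theory $T$ is \emph{finite-dimensional} if there is a function $\dim$ from the interpretable sets of models of $T$ to $\mathbb{N}\cup\{-\infty\}$ such that: $\dim\phi(x,a)$ depends only on the formula $\phi$ and on the type of $a$ over $\emptyset$; $\dim\emptyset=-\infty$, and $\dim X=0$ if and only if $X$ is finite and non-empty; $\dim(X\cup Y)=\max(\dim X,\dim Y)$; and for every interpretable function $f:X\to Y$ and $k\in\mathbb{N}$, if $\dim f^{-1}(y)\ge k$ for all $y\in Y$ then $\dim X\ge\dim Y+k$, and if $\dim f^{-1}(y)\le k$ for all $y\in Y$ then $\dim X\le \dim Y+k$. Let $M$ be a model of a finite-dimensional theory; "definable" means interpretable in $M$ with parameters. Let $\mathfrak g$ be a definable Lie ring whose additive group is torsion-free ($\operatorname{char}(\mathfrak g)=0$), and let $V$ be a definable $\mathfrak g$-module (a definable abelian group with a definable action of $\mathfrak g$). Put $$\widetilde C_{\mathfrak g}(V)=\{x\in\mathfrak g:\ \{v\in V: xv=0\}\text{ has finite index in }V\},$$ an ideal of $\mathfrak g$. Assume that $V$ is minimal (no infinite definable $\mathfrak g$-invariant subgroup has infinite index in $V$) and that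 the action is not almost trivial ($\widetilde C_{\mathfrak g}(V)$ has infinite index in $\mathfrak g$). Then the Lie ring $\mathfrak g/\widetilde C_{\mathfrak g}(V)$ is definable, and: (1) it embeds definably, as a Lie ring, in $\mathfrak{gl}_n(K)$ for some $n\in\mathbb N$ and some definable field $K$ of characteristic $0$; (2) it is virtually connected, that is, it has a smallest definable subgroup of finite index $(\mathfrak g/\widetilde C_{\mathfrak g}(V))^0$; this is a Lie subring, and it is a finite-dimensional Lie algebra, with definable scalar multiplication, over a definable field of characteristic $0$. In particular, let $\mathfrak g$ be a definable Lie ring with torsion-free additive group that is not almost abelian ($\widetilde C_{\mathfrak g}(\mathfrak g)\neq\mathfrak g$ for the adjoint action) and is absolutely simple (no definable Lie subring $\mathfrak h$ of finite index in $\mathfrak g$ has an infinite definable ideal of infinite index in $\mathfrak h$). Then $\mathfrak g$ has a definable Lie subring of finite index that is a simple (in particular non-abelian) finite-dimensional Lie algebra, with definable scalar multiplication, over a definable field of characteristic $0$. -/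

import Mathlib

open FirstOrder

universe u v w

namespace FinDimLie

/-! ### Interpretable sets -/

/-- An interpretable set (a definable set of imaginaries) of the structure `M`: the set of classes
of a partial equivalence relation on `Mⁿ` that is definable with parameters. Its field is the
definable set `{x | rel x x}`. -/
structure InterpSet (L : FirstOrder.Language.{u, v}) (M : Type w) [L.Structure M] (n : ℕ) where
  rel : (Fin n → M) → (Fin n → M) → Prop
  symm : ∀ {x y}, rel x y → rel y x
  trans : ∀ {x y z}, rel x y → rel y z → rel x z
  definable : (Set.univ : Set M).Definable L
    {p : Fin n ⊕ Fin n → M | rel (p ∘ Sum.inl) (p ∘ Sum.inr)}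

namespace InterpSet

variable {L : FirstOrder.Language.{u, v}} {M : Type w} [L.Structure M] {n : ℕ}

/-- The tuples that represent some element. -/
def dom (X : InterpSet L M n) (x : Fin n → M) : Prop := X.rel x x

/-- The equivalence relation induced on the representing tuples. -/
def setoid (X : InterpSet L M n) : Setoid {x : Fin n → M // X.dom x} where
  r x y := X.rel x.1 y.1
  iseqv := ⟨fun x => x.2, fun h => X.symm h, fun h h' => X.trans h h'⟩

/-- The elements of an interpretable set. -/
def Elem (X : InterpSet L M n) : Type w := Quotient X.setoid

/-- The element represented by a tuple. -/
def elem (X : InterpSet L M n) (x : Fin n → M) (hx : X.dom x) : X.Elem :=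
  Quotient.mk X.setoid ⟨x, hx⟩

/-- `X` is a subset of `Z`, both being sets of imaginaries of the same sort. -/
def IsSubset (X Z : InterpSet L M n) : Prop :=
  ∀ x y, X.rel x y ↔ Z.rel x y ∧ X.dom x

end InterpSet

/-- An identification of the set `X` with an interpretable set of `M`. -/
structure Interpretation (L : FirstOrder.Language.{u, v}) (M : Type w) [L.Structure M]
    (X : Type*) where
  arity : ℕ
  carrier : InterpSet L M arity
  equiv : carrier.Elem ≃ X

/-- An interpretable set, seen as a set identified with itself. -/
def InterpSet.self {L : FirstOrder.Language.{u, v}} {M : Type w} [L.Structure M] {n : ℕ}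
    (X : InterpSet L M n) : Interpretation L M X.Elem :=
  ⟨n, X, Equiv.refl _⟩

namespace Interpretation

variable {L : FirstOrder.Language.{u, v}} {M : Type w} [L.Structure M] {X Y Z : Type*}

/-- The tuple `x` represents the element `a`. -/
def Code (I : Interpretation L M X) (x : Fin I.arity → M) (a : X) : Prop :=
  ∃ hx : I.carrier.dom x, I.equiv (I.carrier.elem x hx) = a

/-- Definable (with parameters) subsets. -/
def DefinableSet (I : Interpretation L M X) (S : Set X) : Prop :=
  (Set.univ : Set M).Definable L {x : Fin I.arity → M | ∃ a, I.Code x a ∧ a ∈ S}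

/-- Definable (with parameters) binary relations. -/
def DefinableRel₂ (I : Interpretation L M X) (J : Interpretation L M Y)
    (R : X → Y → Prop) : Prop :=
  (Set.univ : Set M).Definable L {p : Fin I.arity ⊕ Fin J.arity → M |
    ∃ a b, I.Code (p ∘ Sum.inl) a ∧ J.Code (p ∘ Sum.inr) b ∧ R a b}

/-- Definable (with parameters) ternary relations. -/
def DefinableRel₃ (I : Interpretation L M X) (J : Interpretation L M Y)
    (K : Interpretation L M Z) (R : X → Y → Z → Prop) : Prop :=
  (Set.univ : Set M).Definable L {p : (Fin I.arity ⊕ Fin J.arity) ⊕ Fin K.arity → M |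
    ∃ a b c, I.Code (p ∘ Sum.inl ∘ Sum.inl) a ∧ J.Code (p ∘ Sum.inl ∘ Sum.inr) b ∧
      K.Code (p ∘ Sum.inr) c ∧ R a b c}

/-- Definable functions of one variable. -/
def DefinableMap (I : Interpretation L M X) (J : Interpretation L M Y) (f : X → Y) : Prop :=
  I.DefinableRel₂ J fun a b => f a = b

/-- Definable functions of two variables. -/
def DefinableMap₂ (I : Interpretation L M X) (J : Interpretation L M Y)
    (K : Interpretation L M Z) (f : X → Y → Z) : Prop :=
  I.DefinableRel₃ J K fun a b c => f a b = c

/-- The identification makes `K` a definable field. -/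
def IsDefinableField {K : Type*} [Field K] (F : Interpretation L M K) : Prop :=
  F.DefinableMap₂ F F (fun a b => a + b) ∧ F.DefinableMap₂ F F (fun a b => a * b)

/-- The identification makes `𝔤` a definable Lie ring. -/
def IsDefinableLieRing {𝔤 : Type*} [LieRing 𝔤] (I : Interpretation L M 𝔤) : Prop :=
  I.DefinableMap₂ I I (fun x y => x + y) ∧ I.DefinableMap₂ I I (fun x y => ⁅x, y⁆)

/-- The identifications make `(𝔤, V)` a definable module: the Lie ring `𝔤`, the abelian group `V`
and the action are all definable. -/
def IsDefinableModule {𝔤 V : Type*} [LieRing 𝔤] [AddCommGroup V] [LieRingModule 𝔤 V]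
    (I : Interpretation L M 𝔤) (J : Interpretation L M V) : Prop :=
  I.IsDefinableLieRing ∧ J.DefinableMap₂ J J (fun a b => a + b) ∧
    I.DefinableMap₂ J J (fun x a => ⁅x, a⁆)

/-- `H` is the connected component of the definable abelian group `X`: the smallest definable
subgroup of finite index. The group is virtually connected when it has one. -/
def IsConnectedComponent {X : Type*} [AddCommGroup X] (I : Interpretation L M X)
    (H : AddSubgroup X) : Prop :=
  I.DefinableSet (H : Set X) ∧ H.FiniteIndex ∧
    ∀ H' : AddSubgroup X, I.DefinableSet (H' : Set X) → H'.FiniteIndex → H ≤ H'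

/-- The subring `𝔥` of the definable Lie ring `𝔤` is a finite-dimensional Lie algebra over the
definable field `K` for the given structure: the scalar multiplication is definable. -/
def IsDefinableLieAlgebra {K 𝔤 : Type*} [Field K] [LieRing 𝔤] (F : Interpretation L M K)
    (I : Interpretation L M 𝔤) (𝔥 : LieSubalgebra ℤ 𝔤) [LieAlgebra K 𝔥] : Prop :=
  F.IsDefinableField ∧ Module.Finite K 𝔥 ∧
    F.DefinableRel₃ I I fun k x y => ∃ hx : x ∈ 𝔥, ((k • (⟨x, hx⟩ : 𝔥) : 𝔥) : 𝔤) = y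

/-- The definable Lie ring `𝔤` is absolutely simple: no definable Lie subring `𝔥` of finite index
has an infinite definable ideal of infinite index. -/
def IsAbsolutelySimple {𝔤 : Type*} [LieRing 𝔤] (I : Interpretation L M 𝔤) : Prop :=
  ∀ 𝔥 : LieSubalgebra ℤ 𝔤, I.DefinableSet (𝔥 : Set 𝔤) →
    𝔥.toSubmodule.toAddSubgroup.FiniteIndex →
    ∀ J : AddSubgroup 𝔤, I.DefinableSet (J : Set 𝔤) → (∀ y ∈ J, y ∈ 𝔥) →
      (∀ x ∈ 𝔥, ∀ y ∈ J, ⁅x, y⁆ ∈ J) →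
      (J : Set 𝔤).Finite ∨ J.IsFiniteRelIndex 𝔥.toSubmodule.toAddSubgroup

/-- The module `V` is `𝔤`-minimal: it has no infinite definable `𝔤`-invariant subgroup of infinite
index. -/
def IsMinimalModule (𝔤 : Type*) {V : Type*} [LieRing 𝔤] [AddCommGroup V] [LieRingModule 𝔤 V]
    (J : Interpretation L M V) : Prop :=
  ∀ W : AddSubgroup V, J.DefinableSet (W : Set V) → (∀ x : 𝔤, ∀ a ∈ W, ⁅x, a⁆ ∈ W) →
    (W : Set V).Finite ∨ W.FiniteIndex

end Interpretation

/-- The fibres of a definable function are interpretable. -/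
theorem InterpSet.exists_fibre {L : FirstOrder.Language.{u, v}} {M : Type w} [L.Structure M]
    {n m : ℕ} (X : InterpSet L M n) (Y : InterpSet L M m) (f : X.Elem → Y.Elem)
    (hf : X.self.DefinableMap Y.self f) (b : Y.Elem) :
    ∃ F : InterpSet L M n, F.IsSubset X ∧
      ∀ x, F.dom x ↔ ∃ hx : X.dom x, f (X.elem x hx) = b := by
  obtain ⟨⟨y, hy⟩, rfl⟩ := Quotient.exists_rep b
  have hc : ∀ c : M, (Set.univ : Set M).Definable₁ L {c} := fun c =>
    Set.Definable.singleton_of_mem L (Set.mem_univ c)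
  have h₁ : (Set.univ : Set M).Definable L {p : Fin n ⊕ Fin m → M | p ∘ Sum.inr = y} := by
    have h := Set.definable_biInter_finset (A := (Set.univ : Set M)) (L := L)
      (f := fun j : Fin m => {p : Fin n ⊕ Fin m → M | p (Sum.inr j) = y j})
      (fun j => (hc (y j)).preimage_comp (fun _ : Fin 1 => (Sum.inr j : Fin n ⊕ Fin m)))
      Finset.univ
    refine (congrArg _ (Set.ext fun p => ?_)).mp h
    simp [funext_iff]
  have h₂ := (Set.Definable.inter hf h₁).image_comp (Sum.inl : Fin n → Fin n ⊕ Fin m)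
  have h₃ : (Set.univ : Set M).Definable L
      {x : Fin n → M | ∃ hx : X.dom x, f (X.elem x hx) = Y.elem y hy} := by
    refine (congrArg _ (Set.ext fun x => ?_)).mp h₂
    constructor
    · rintro ⟨p, ⟨⟨a, c, ⟨ha, rfl⟩, ⟨hc', rfl⟩, h⟩, hp⟩, rfl⟩
      refine ⟨ha, h.trans ?_⟩
      change p ∘ Sum.inr = y at hp
      subst hp
      rfl
    · rintro ⟨hx, h⟩
      exact ⟨Sum.elim x y, ⟨⟨_, _, ⟨hx, rfl⟩, ⟨hy, rfl⟩, h⟩, rfl⟩, rfl⟩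
  refine ⟨⟨fun x x' => X.rel x x' ∧ ∃ hx : X.dom x, f (X.elem x hx) = Y.elem y hy, ?_, ?_, ?_⟩,
    ?_, ?_⟩
  · rintro x x' ⟨h, hx, e⟩
    have hx' : X.dom x' := X.trans (X.symm h) h
    have : X.elem x' hx' = X.elem x hx := Quotient.sound (X.symm h)
    exact ⟨X.symm h, hx', by rw [this, e]⟩
  · rintro x x' x'' ⟨h, hx⟩ ⟨h', -⟩
    exact ⟨X.trans h h', hx⟩
  · exact Set.Definable.inter X.definable (h₃.preimage_comp Sum.inl)
  · intro x x'
    exact ⟨fun ⟨h, hx, e⟩ => ⟨h, hx, hx, e⟩, fun ⟨h, _, hx⟩ => ⟨h, hx⟩⟩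
  · exact fun x => ⟨fun h => h.2, fun ⟨hx, e⟩ => ⟨hx, hx, e⟩⟩

/-! ### Finite-dimensional theories -/

/-- The axioms of a (finite) dimension on the interpretable sets of the models of `T`.
The value `⊥` stands for `-∞`. -/
structure IsDimension {L : FirstOrder.Language.{u, v}} (T : L.Theory)
    (dim : ∀ (M : Type w) [L.Structure M] [T.Model M] [Nonempty M] {n : ℕ},
      InterpSet L M n → WithBot ℕ) : Prop where
  /-- The dimension of the set defined by `φ(·, a)` depends only on `φ` and the type of `a`. -/
  invariance : ∀ (M N : Type w) [L.Structure M] [T.Model M] [Nonempty M]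
    [L.Structure N] [T.Model N] [Nonempty N] {n m : ℕ}
    (φ : L.Formula ((Fin n ⊕ Fin n) ⊕ Fin m)) (a : Fin m → M) (b : Fin m → N)
    (X : InterpSet L M n) (Y : InterpSet L N n),
    (∀ ψ : L.Formula (Fin m), ψ.Realize a ↔ ψ.Realize b) →
    (∀ x y, X.rel x y ↔ φ.Realize (Sum.elim (Sum.elim x y) a)) →
    (∀ x y, Y.rel x y ↔ φ.Realize (Sum.elim (Sum.elim x y) b)) →
    dim M X = dim N Y
  empty : ∀ (M : Type w) [L.Structure M] [T.Model M] [Nonempty M] {n : ℕ} (X : InterpSet L M n),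
    IsEmpty X.Elem → dim M X = ⊥
  eq_zero_iff : ∀ (M : Type w) [L.Structure M] [T.Model M] [Nonempty M] {n : ℕ}
    (X : InterpSet L M n), dim M X = 0 ↔ Nonempty X.Elem ∧ Finite X.Elem
  /-- The dimension of `Z = X ∪ Y`. -/
  union : ∀ (M : Type w) [L.Structure M] [T.Model M] [Nonempty M] {n : ℕ}
    (X Y Z : InterpSet L M n), X.IsSubset Z → Y.IsSubset Z →
    (∀ x, Z.dom x → X.dom x ∨ Y.dom x) → dim M Z = max (dim M X) (dim M Y)
  /-- If all fibres of `f : X → Y` have dimension at least `k`, then `dim X ≥ dim Y + k`. -/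
  fibre_ge : ∀ (M : Type w) [L.Structure M] [T.Model M] [Nonempty M] {n m : ℕ}
    (X : InterpSet L M n) (Y : InterpSet L M m) (f : X.Elem → Y.Elem) (k : ℕ),
    X.self.DefinableMap Y.self f →
    (∀ (b : Y.Elem) (F : InterpSet L M n), F.IsSubset X →
      (∀ x, F.dom x ↔ ∃ hx : X.dom x, f (X.elem x hx) = b) → (k : WithBot ℕ) ≤ dim M F) →
    dim M Y + k ≤ dim M X
  /-- If all fibres of `f : X → Y` have dimension at most `k`, then `dim X ≤ dim Y + k`. -/
  fibre_le : ∀ (M : Type w) [L.Structure M] [T.Model M] [Nonempty M] {n m : ℕ}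
    (X : InterpSet L M n) (Y : InterpSet L M m) (f : X.Elem → Y.Elem) (k : ℕ),
    X.self.DefinableMap Y.self f →
    (∀ (b : Y.Elem) (F : InterpSet L M n), F.IsSubset X →
      (∀ x, F.dom x ↔ ∃ hx : X.dom x, f (X.elem x hx) = b) → dim M F ≤ (k : WithBot ℕ)) →
    dim M X ≤ dim M Y + k

/-- The theory `T` is finite-dimensional (its models being taken in the universe `w`). -/
def IsFiniteDimensional {L : FirstOrder.Language.{u, v}} (T : L.Theory) : Prop :=
  ∃ dim : ∀ (M : Type w) [L.Structure M] [T.Model M] [Nonempty M] {n : ℕ},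
    InterpSet L M n → WithBot ℕ, IsDimension T dim

/-! ### Almost centralisers -/

section Almost

variable (𝔤 V : Type*) [LieRing 𝔤] [AddCommGroup V] [LieRingModule 𝔤 V]

/-- `C_V(x)`, the set of the `a ∈ V` with `⁅x, a⁆ = 0`. -/
def centralizerIn {𝔤 : Type*} [LieRing 𝔤] [LieRingModule 𝔤 V] (x : 𝔤) : AddSubgroup V where
  carrier := {a | ⁅x, a⁆ = 0}
  zero_mem' := lie_zero x
  add_mem' := fun {a b} ha hb => by
    simp only [Set.mem_ofPred_eq] at ha hb ⊢
    rw [lie_add, ha, hb, add_zero]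
  neg_mem' := fun {a} ha => by
    simp only [Set.mem_ofPred_eq] at ha ⊢
    rw [lie_neg, ha, neg_zero]

/-- The almost centraliser of `V` in `𝔤`: the ideal of the `x ∈ 𝔤` such that `C_V(x)` has finite
index in `V`. -/
def almostCentralizer : LieIdeal ℤ 𝔤 where
  carrier := {x | (centralizerIn V x).FiniteIndex}
  zero_mem' := by
    have h : centralizerIn V (0 : 𝔤) = ⊤ := eq_top_iff.2 fun a _ => zero_lie a
    simp only [Set.mem_ofPred_eq, h]
    infer_instance
  add_mem' := fun {x y} hx hy => by
    simp only [Set.mem_ofPred_eq] at hx hy ⊢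
    have h : centralizerIn V x ⊓ centralizerIn V y ≤ centralizerIn V (x + y) := by
      rintro a ⟨(h₁ : ⁅x, a⁆ = 0), (h₂ : ⁅y, a⁆ = 0)⟩
      change ⁅x + y, a⁆ = 0
      rw [add_lie, h₁, h₂, add_zero]
    exact AddSubgroup.finiteIndex_of_le h
  smul_mem' := fun k x hx => by
    simp only [Set.mem_ofPred_eq] at hx ⊢
    have h : centralizerIn V x ≤ centralizerIn V (k • x) := by
      intro a (h₁ : ⁅x, a⁆ = 0)
      let f : 𝔤 →+ V := ⟨⟨fun z => ⁅z, a⁆, zero_lie a⟩, fun y z => add_lie y z a⟩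
      change f (k • x) = 0
      rw [map_zsmul, show f x = 0 from h₁, smul_zero]
    exact AddSubgroup.finiteIndex_of_le h
  lie_mem := fun {y x} hx => by
    change (centralizerIn V x).FiniteIndex at hx
    change (centralizerIn V ⁅y, x⁆).FiniteIndex
    let f : V →+ V := ⟨⟨fun a => ⁅y, a⁆, lie_zero y⟩, fun a b => lie_add y a b⟩
    have h : centralizerIn V x ⊓ (centralizerIn V x).comap f ≤ centralizerIn V ⁅y, x⁆ := by
      rintro a ⟨(h₁ : ⁅x, a⁆ = 0), (h₂ : ⁅x, ⁅y, a⁆⁆ = 0)⟩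
      change ⁅⁅y, x⁆, a⁆ = 0
      rw [lie_lie, h₁, h₂, lie_zero, sub_zero]
    have h' : ((centralizerIn V x).comap f).FiniteIndex := ⟨by
      rw [AddSubgroup.index_comap]
      exact AddSubgroup.FiniteIndex.index_ne_zero⟩
    exact AddSubgroup.finiteIndex_of_le h

/-- The action of `𝔤` on `V` is almost trivial: the almost centraliser of `V` has finite index
in `𝔤`. -/
def IsAlmostTrivial : Prop := Finite (𝔤 ⧸ almostCentralizer 𝔤 V)

/-- The Lie ring `𝔤` is almost abelian: it is equal to its almost centre, the almost centraliser of
`𝔤` for the adjoint action. -/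
def IsAlmostAbelian : Prop := almostCentralizer 𝔤 𝔤 = ⊤

end Almost

end FinDimLie

open FinDimLie

/-!
The group-theoretic input from the dimension is a chain condition. A uniformly definable sequence
of subgroups `(Hₙ)` of a definable abelian group `G` defines a subgroup of an ultrapower of `G`,
whose quotient is interpretable and has a dimension. This dimension is antitone, and it drops from
`(Kₙ)` to `(Hₙ)` when `Hₙ ≤ Kₙ` has index at least `n` for all `n` (`exists_codim`). Hence there
are no infinite chains of such sequences. Write `H ≲ K` if some positive multiple of `H` lies in
`K` (`AlmostLE`). Three consequences carry everything that follows: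
* definable subgroups satisfy both chain conditions up to `≲` (`exists_maximal_almostLE`,
  `exists_minimal_almostLE`);
* in a definable family of subgroups, the multiple that witnesses `S ≲ W b`, or `W b ≲ 0`, can be
  chosen independently of `b` (`exists_nsmul_mem_of_almostLE`,
  `exists_nsmul_eq_zero_of_almostLE`);
* an injective definable endomorphism has a range of finite index, so that an action annihilated
  by a positive integer is almost trivial when the Lie ring is torsion-free.

Let `𝔤` act on the minimal module `V`. Take a definable almost invariant subgroup `W`, minimal up
to `≲` among those with `W ≴ 0`. For `a ∈ W` the sums of values at `a` of finitely many monomials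
in the action form a definable group, the orbit of `a`; for suitable monomials and a suitable `a`
it is almost equal to `W`. The orbits of the multiples `k a` belong to a single definable family,
and the orbit of `k a` is `k` times the orbit of `a`. By uniformity `N W ⊆ k W` for a fixed `N`
and all `k`, so `U = N W` is divisible; a similar family of annihilators shows that it is
torsion-free. It is a definable submodule that is irreducible in a strong sense
(`exists_irreducible_submodule`), and it has finite index in `V`. Being divisible, it is
annihilated by `x` exactly when `x` is in the almost centraliser.

By Schur's lemma the endomorphisms of the module `U` form a division ring. An endomorphism is
determined by its value at a point `a ≠ 0`, and the chain condition shows that the set of these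
values is definable: it consists of the elements annihilated by the `γ` with `γ a = 0`, where `γ`
is a sum of finitely many fixed monomials (`exists_annClosure_eq`). So the centre of the division
ring is a definable field `K` of characteristic zero (`exists_field`). By the ascending chain
condition `U` has finite dimension over `K`, and the action on `U` embeds the quotient of `𝔤` by
the almost centraliser in a ring of matrices over `K` (`exists_matrix`, `exists_representation`).

The scalars in `K` that preserve the image of this embedding form a definable subring. A definable
subring of a definable field of characteristic zero is a field (`inv_mem_of_isDef`), so the
quotient is a Lie algebra over this subfield, of finite dimension (`exists_lieAlgebra_of_matrix`).
It is divisible, hence has no proper subgroup of finite index and is its own connected component.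

For the last assertion, absolute simplicity makes `𝔤` minimal as a module over itself. The almost
centre is the centre because `𝔤` is torsion-free, and it is a definable ideal of infinite index,
hence finite, hence zero. Thus `𝔤` itself is a Lie algebra of finite dimension, whose ideals are
definable as subspaces, so they are finite or of finite index, that is, zero or everything.
-/

namespace FinDimLie

/-! ### Definability on coded types -/

/-- A coding of the elements of a type `X` by tuples of the structure `M`, for which the set of
codes and the relation of coding the same element are definable with parameters. It is an
interpretation of `X` in `M`, with tuples indexed by any finite type instead of `Fin n`: products of
coded types are then coded by tuples indexed by a sum type. -/
class Coding (L : FirstOrder.Language.{u, v}) (M : Type w) [L.Structure M] (X : Type*) where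
  ι : Type
  finite : Finite ι
  Code : (ι → M) → X → Prop
  unique : ∀ {c x y}, Code c x → Code c y → x = y
  exists_code : ∀ x, ∃ c, Code c x
  definable : (Set.univ : Set M).Definable L
    {p : ι ⊕ ι → M | ∃ x, Code (p ∘ Sum.inl) x ∧ Code (p ∘ Sum.inr) x}

attribute [instance] Coding.finite

section Coding

variable (L : FirstOrder.Language.{u, v}) (M : Type w) [L.Structure M]

/-- A predicate on a coded type is definable (with parameters) if the set of the codes of the
elements that satisfy it is. -/
def IsDef {X : Type*} [C : Coding L M X] (p : X → Prop) : Prop :=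
  (Set.univ : Set M).Definable L {c : C.ι → M | ∃ x, C.Code c x ∧ p x}

variable {X Y Z W : Type*}

instance Coding.prod [C : Coding L M X] [D : Coding L M Y] : Coding L M (X × Y) where
  ι := C.ι ⊕ D.ι
  finite := inferInstance
  Code c x := C.Code (c ∘ Sum.inl) x.1 ∧ D.Code (c ∘ Sum.inr) x.2
  unique h h' := Prod.ext (C.unique h.1 h'.1) (D.unique h.2 h'.2)
  exists_code x := by
    obtain ⟨c, hc⟩ := C.exists_code x.1
    obtain ⟨d, hd⟩ := D.exists_code x.2
    exact ⟨Sum.elim c d, hc, hd⟩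
  definable := by
    have h₁ := C.definable.preimage_comp
      (Sum.map Sum.inl Sum.inl : C.ι ⊕ C.ι → (C.ι ⊕ D.ι) ⊕ (C.ι ⊕ D.ι))
    have h₂ := D.definable.preimage_comp
      (Sum.map Sum.inr Sum.inr : D.ι ⊕ D.ι → (C.ι ⊕ D.ι) ⊕ (C.ι ⊕ D.ι))
    refine (congrArg _ (Set.ext fun p => ?_)).mp (h₁.inter h₂)
    constructor
    · rintro ⟨⟨x, hx, hx'⟩, y, hy, hy'⟩
      exact ⟨(x, y), ⟨hx, hy⟩, hx', hy'⟩
    · rintro ⟨⟨x, y⟩, ⟨hx, hy⟩, hx', hy'⟩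
      exact ⟨⟨x, hx, hx'⟩, y, hy, hy'⟩

/-- The coding of the tuples of `M` by themselves. -/
instance Coding.tuples (κ : Type) [Finite κ] : Coding L M (κ → M) where
  ι := κ
  finite := inferInstance
  Code c x := c = x
  unique h h' := h.symm.trans h'
  exists_code x := ⟨x, rfl⟩
  definable := by
    have h : ∀ k : κ, (Set.univ : Set M).Definable L
        {p : κ ⊕ κ → M | p (Sum.inl k) = p (Sum.inr k)} := fun k =>
      (Set.Definable.diagonal (L := L) (Set.univ : Set M)).preimage_comp
        (fun i : Fin 2 => if i = 0 then (Sum.inl k : κ ⊕ κ) else Sum.inr k)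
    refine (congrArg _ (Set.ext fun p => ?_)).mp (Set.definable_iInter_of_finite h)
    simp only [Set.mem_iInter, Set.mem_ofPred_eq]
    constructor
    · exact fun h => ⟨p ∘ Sum.inr, funext h, rfl⟩
    · rintro ⟨x, h, h'⟩ k
      exact congrFun (h.trans h'.symm) k

/-- An injection with definable range into a coded type gives a coding. -/
@[reducible] def Coding.ofInjective [C : Coding L M X] (f : Y → X) (hf : Function.Injective f)
    (h : IsDef L M (· ∈ Set.range f)) : Coding L M Y where
  ι := C.ι
  finite := inferInstance
  Code c y := C.Code c (f y)
  unique h h' := hf (C.unique h h')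
  exists_code y := C.exists_code (f y)
  definable := by
    refine (congrArg _ (Set.ext fun p => ?_)).mp
      (C.definable.inter (h.preimage_comp (Sum.inl : C.ι → C.ι ⊕ C.ι)))
    constructor
    · rintro ⟨⟨x, hx, hx'⟩, _, hy, y, rfl⟩
      obtain rfl := C.unique hx hy
      exact ⟨y, hx, hx'⟩
    · rintro ⟨y, hy, hy'⟩
      exact ⟨⟨f y, hy, hy'⟩, f y, hy, y, rfl⟩

/-- A surjection with definable kernel from a coded type gives a coding. -/
@[reducible] def Coding.ofSurjective [C : Coding L M X] (f : X → Y) (hf : Function.Surjective f)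
    (h : IsDef L M (fun p : X × X => f p.1 = f p.2)) : Coding L M Y where
  ι := C.ι
  finite := inferInstance
  Code c y := ∃ x, C.Code c x ∧ f x = y
  unique := by
    rintro c _ _ ⟨x, hx, rfl⟩ ⟨x', hx', rfl⟩
    rw [C.unique hx hx']
  exists_code y := by
    obtain ⟨x, rfl⟩ := hf y
    obtain ⟨c, hc⟩ := C.exists_code x
    exact ⟨c, x, hc, rfl⟩
  definable := by
    refine (congrArg _ (Set.ext fun p => ?_)).mp h
    constructor
    · rintro ⟨⟨x, x'⟩, ⟨hx, hx'⟩, e⟩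
      exact ⟨f x, ⟨x, hx, rfl⟩, x', hx', e.symm⟩
    · rintro ⟨_, ⟨x, hx, rfl⟩, x', hx', e⟩
      exact ⟨(x, x'), ⟨hx, hx'⟩, e.symm⟩

/-- A map between coded types is definable if its graph is. -/
@[fun_prop] def IsDefMap [Coding L M X] [Coding L M Y] (f : X → Y) : Prop :=
  IsDef L M (fun q : X × Y => f q.1 = q.2)

/-- A map between coded types for which a code of the image of `x` is part of a code of `x`:
the projections of products, and the maps composed of them. -/
def IsReindexing [C : Coding L M X] [D : Coding L M Y] (f : X → Y) : Prop :=
  ∃ σ : D.ι → C.ι, ∀ c x, C.Code c x → D.Code (c ∘ σ) (f x)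

variable {L M}

section Reindexing

variable [Coding L M X] [Coding L M Y] [Coding L M Z]

theorem IsReindexing.fst : IsReindexing L M (Prod.fst : X × Y → X) :=
  ⟨Sum.inl, fun _ _ h => h.1⟩

theorem IsReindexing.snd : IsReindexing L M (Prod.snd : X × Y → Y) :=
  ⟨Sum.inr, fun _ _ h => h.2⟩

theorem IsReindexing.comp {g : Y → Z} {f : X → Y} (hg : IsReindexing L M g)
    (hf : IsReindexing L M f) : IsReindexing L M (fun x => g (f x)) := by
  obtain ⟨σ, hσ⟩ := hg
  obtain ⟨τ, hτ⟩ := hf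
  exact ⟨τ ∘ σ, fun c x h => hσ _ _ (hτ c x h)⟩

theorem IsReindexing.prodMk {f : X → Y} {g : X → Z} (hf : IsReindexing L M f)
    (hg : IsReindexing L M g) : IsReindexing L M (fun x => (f x, g x)) := by
  obtain ⟨σ, hσ⟩ := hf
  obtain ⟨τ, hτ⟩ := hg
  exact ⟨Sum.elim σ τ, fun c x h => ⟨hσ c x h, hτ c x h⟩⟩

end Reindexing

theorem IsDef.of_definable [C : Coding L M X] {p : X → Prop} {s : Set (C.ι → M)}
    (hs : (Set.univ : Set M).Definable L s) (h : ∀ c, c ∈ s ↔ ∃ x, C.Code c x ∧ p x) :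
    IsDef L M p :=
  (congrArg _ (Set.ext h)).mp hs

theorem IsDef.true [C : Coding L M X] : IsDef L M (fun _ : X => True) := by
  refine IsDef.of_definable (C.definable.preimage_comp (Sum.elim id id)) fun p => ?_
  exact ⟨fun ⟨x, h, _⟩ => ⟨x, h, trivial⟩, fun ⟨x, h, _⟩ => ⟨x, h, h⟩⟩

theorem IsDef.and [C : Coding L M X] {p q : X → Prop} (hp : IsDef L M p) (hq : IsDef L M q) :
    IsDef L M (fun x => p x ∧ q x) := by
  refine IsDef.of_definable (hp.inter hq) fun c => ?_
  constructor
  · rintro ⟨⟨x, hx, h⟩, y, hy, h'⟩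
    obtain rfl := C.unique hx hy
    exact ⟨x, hx, h, h'⟩
  · rintro ⟨x, hx, h, h'⟩
    exact ⟨⟨x, hx, h⟩, x, hx, h'⟩

theorem IsDef.not [C : Coding L M X] {p : X → Prop} (hp : IsDef L M p) :
    IsDef L M (fun x => ¬ p x) := by
  refine IsDef.of_definable (IsDef.true.sdiff hp) fun c => ?_
  constructor
  · rintro ⟨⟨x, hx, -⟩, h⟩
    exact ⟨x, hx, fun h' => h ⟨x, hx, h'⟩⟩
  · rintro ⟨x, hx, h⟩
    refine ⟨⟨x, hx, trivial⟩, ?_⟩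
    rintro ⟨y, hy, h'⟩
    obtain rfl := C.unique hx hy
    exact h h'

theorem IsDef.imp [Coding L M X] {p q : X → Prop} (hp : IsDef L M p) (hq : IsDef L M q) :
    IsDef L M (fun x => p x → q x) := by
  simpa only [not_and, not_not] using (hp.and hq.not).not

theorem IsDef.exists [C : Coding L M X] [D : Coding L M Y] {p : X → Y → Prop}
    (hp : IsDef L M (fun q : X × Y => p q.1 q.2)) : IsDef L M (fun x => ∃ y, p x y) := by
  refine IsDef.of_definable (hp.image_comp (Sum.inl : C.ι → C.ι ⊕ D.ι)) fun c => ?_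
  constructor
  · rintro ⟨d, ⟨⟨x, y⟩, ⟨hx, hy⟩, h⟩, rfl⟩
    exact ⟨x, hx, y, h⟩
  · rintro ⟨x, hx, y, h⟩
    obtain ⟨d, hd⟩ := D.exists_code y
    exact ⟨Sum.elim c d, ⟨(x, y), ⟨hx, hd⟩, h⟩, rfl⟩

theorem IsDef.forall [Coding L M X] [Coding L M Y] {p : X → Y → Prop}
    (hp : IsDef L M (fun q : X × Y => p q.1 q.2)) : IsDef L M (fun x => ∀ y, p x y) := by
  simpa only [not_exists, not_not] using (IsDef.exists (p := fun x y => ¬ p x y) hp.not).not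

theorem IsDef.reindex [C : Coding L M X] [D : Coding L M Y] {p : Y → Prop} (hp : IsDef L M p)
    {f : X → Y} (hf : IsReindexing L M f) : IsDef L M (fun x => p (f x)) := by
  obtain ⟨σ, hσ⟩ := hf
  refine IsDef.of_definable ((IsDef.true (X := X)).inter (hp.preimage_comp σ)) fun c => ?_
  constructor
  · rintro ⟨⟨x, hx, -⟩, y, hy, h⟩
    obtain rfl := D.unique (hσ c x hx) hy
    exact ⟨x, hx, h⟩
  · rintro ⟨x, hx, h⟩
    exact ⟨⟨x, hx, trivial⟩, f x, hσ c x hx, h⟩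

theorem IsDef.eq' [C : Coding L M X] : IsDef L M (fun q : X × X => q.1 = q.2) := by
  refine IsDef.of_definable C.definable fun c => ?_
  constructor
  · rintro ⟨x, hx, hx'⟩
    exact ⟨(x, x), ⟨hx, hx'⟩, rfl⟩
  · rintro ⟨⟨x, y⟩, ⟨hx, hy⟩, rfl : x = y⟩
    exact ⟨x, hx, hy⟩

theorem IsReindexing.isDefMap [Coding L M X] [Coding L M Y] {f : X → Y}
    (hf : IsReindexing L M f) : IsDefMap L M f :=
  IsDef.eq'.reindex ((hf.comp .fst).prodMk .snd)

section Maps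

variable [Coding L M X] [Coding L M Y] [Coding L M Z] [Coding L M W]

@[fun_prop] theorem IsDefMap.id : IsDefMap L M (fun x : X => x) := IsDef.eq'

@[fun_prop] theorem IsDefMap.fst : IsDefMap L M (Prod.fst : X × Y → X) :=
  IsReindexing.fst.isDefMap

@[fun_prop] theorem IsDefMap.snd : IsDefMap L M (Prod.snd : X × Y → Y) :=
  IsReindexing.snd.isDefMap

theorem IsDef.comp {p : Y → Prop} (hp : IsDef L M p) {f : X → Y} (hf : IsDefMap L M f) :
    IsDef L M (fun x => p (f x)) := by
  have h := IsDef.exists (p := fun x y => f x = y ∧ p y) (IsDef.and hf (hp.reindex .snd))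
  simpa only [exists_eq_left'] using h

@[fun_prop] theorem IsDefMap.comp {g : Y → Z} {f : X → Y} (hg : IsDefMap L M g)
    (hf : IsDefMap L M f) : IsDefMap L M (fun x => g (f x)) := by
  have h := IsDef.exists (X := X × Z) (p := fun x y => f x.1 = y ∧ g y = x.2)
    (IsDef.and
      (IsDef.reindex hf ((IsReindexing.fst.comp .fst).prodMk .snd))
      (IsDef.reindex hg (IsReindexing.snd.prodMk (IsReindexing.snd.comp .fst))))
  simpa only [exists_eq_left', IsDefMap] using h

@[fun_prop] theorem IsDefMap.prodMk {f : X → Y} {g : X → Z} (hf : IsDefMap L M f)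
    (hg : IsDefMap L M g) : IsDefMap L M (fun x => (f x, g x)) := by
  have h := IsDef.and
    (IsDef.reindex hf (IsReindexing.fst.prodMk (IsReindexing.fst.comp .snd)))
    (IsDef.reindex (X := X × (Y × Z)) hg (IsReindexing.fst.prodMk (IsReindexing.snd.comp .snd)))
  simpa only [IsDefMap, Prod.ext_iff] using h

theorem IsDef.eq {f g : X → Y} (hf : IsDefMap L M f) (hg : IsDefMap L M g) :
    IsDef L M (fun x => f x = g x) :=
  IsDef.comp IsDef.eq' (hf.prodMk hg)

/-- Elements of coded types may be used as parameters. -/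
theorem IsDef.eq_const (y : Y) : IsDef L M (fun y' : Y => y' = y) := by
  obtain ⟨d, hd⟩ := Coding.exists_code (L := L) (M := M) y
  have h₁ : (Set.univ : Set M).Definable L
      {p : Coding.ι L M Y ⊕ Coding.ι L M Y → M | p ∘ Sum.inr = d} := by
    have h := Set.definable_iInter_of_finite (A := (Set.univ : Set M)) (L := L)
      (f := fun j : Coding.ι L M Y =>
        {p : Coding.ι L M Y ⊕ Coding.ι L M Y → M | p (Sum.inr j) = d j})
      (fun j => (Set.Definable.singleton_of_mem L (Set.mem_univ (d j))).preimage_comp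
        (fun _ : Fin 1 => (Sum.inr j : Coding.ι L M Y ⊕ Coding.ι L M Y)))
    refine (congrArg _ (Set.ext fun p => ?_)).mp h
    simp [funext_iff]
  have h₂ := (h₁.inter (Coding.definable (L := L) (M := M) (X := Y))).image_comp
    (Sum.inl : Coding.ι L M Y → Coding.ι L M Y ⊕ Coding.ι L M Y)
  refine IsDef.of_definable h₂ fun c => ?_
  constructor
  · rintro ⟨p, ⟨h, y', h', h''⟩, rfl⟩
    change p ∘ Sum.inr = d at h
    rw [h] at h''
    exact ⟨y', h', Coding.unique h'' hd⟩
  · rintro ⟨y', h, e⟩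
    exact ⟨Sum.elim c d, ⟨rfl, y', h, e ▸ hd⟩, rfl⟩

@[fun_prop] theorem IsDefMap.const (y : Y) : IsDefMap L M (fun _ : X => y) := by
  have h : IsDef L M (fun q : X × Y => q.2 = y) := (IsDef.eq_const y).reindex .snd
  simpa only [IsDefMap, eq_comm] using h

/-- An image of a definable set under a definable map is definable. -/
theorem IsDef.image {p : X → Prop} (hp : IsDef L M p) {f : X → Y} (hf : IsDefMap L M f) :
    IsDef L M (fun y => ∃ x, p x ∧ f x = y) :=
  IsDef.exists (p := fun y x => p x ∧ f x = y)
    ((hp.reindex .snd).and (IsDef.eq (by fun_prop) (by fun_prop)))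

end Maps

theorem Coding.isDefMap_ofInjective [Coding L M X] (f : Y → X) (hf : Function.Injective f)
    (h : IsDef L M (· ∈ Set.range f)) :
    let _ := Coding.ofInjective L M f hf h
    IsDefMap L M f := by
  let _ := Coding.ofInjective L M f hf h
  exact IsReindexing.isDefMap ⟨_root_.id, fun _ _ h => h⟩

theorem Coding.isDefMap_ofSurjective [Coding L M X] (f : X → Y) (hf : Function.Surjective f)
    (h : IsDef L M (fun p : X × X => f p.1 = f p.2)) :
    let _ := Coding.ofSurjective L M f hf h
    IsDefMap L M f := by
  let _ := Coding.ofSurjective L M f hf h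
  exact IsReindexing.isDefMap ⟨_root_.id, fun c x h => ⟨x, h, rfl⟩⟩

/-- A map into `Y` is definable if its composite with a definable injection is. -/
theorem IsDefMap.of_comp_injective [Coding L M X] [Coding L M Y] [Coding L M Z] {f : X → Y}
    {g : Y → Z} (hg : IsDefMap L M g) (hg' : Function.Injective g)
    (h : IsDefMap L M (fun x => g (f x))) : IsDefMap L M f := by
  have := IsDef.eq (X := X × Y) (L := L) (M := M) (f := fun q => g (f q.1)) (g := fun q => g q.2)
    (h.comp IsDefMap.fst) (by fun_prop)
  simpa only [hg'.eq_iff, IsDefMap] using this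

end Coding

end FinDimLie

namespace FinDimLie

/-! ### Dimension of quotients by definable equivalence relations -/

section Dimension

variable {L : FirstOrder.Language.{u, v}} {T : L.Theory}
  {dim : ∀ (M : Type w) [L.Structure M] [T.Model M] [Nonempty M] {n : ℕ},
    InterpSet L M n → WithBot ℕ}

theorem InterpSet.elem_eq_iff {M : Type w} [L.Structure M] {n : ℕ} (X : InterpSet L M n)
    {x y : Fin n → M} (hx : X.dom x) (hy : X.dom y) : X.elem x hx = X.elem y hy ↔ X.rel x y :=
  Quotient.eq (r := X.setoid)

/-- The projection from `X` onto `Y` when `Y` is a coarser equivalence relation on a set that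
contains the one on which `X` lives. -/
def InterpSet.proj {M : Type w} [L.Structure M] {n : ℕ} (X Y : InterpSet L M n)
    (h : ∀ x y, X.rel x y → Y.rel x y) : X.Elem → Y.Elem :=
  Quotient.map (fun x => ⟨x.1, h _ _ x.2⟩) fun _ _ e => h _ _ e

theorem InterpSet.definableMap_proj {M : Type w} [L.Structure M] {n : ℕ} (X Y : InterpSet L M n)
    (h : ∀ x y, X.rel x y → Y.rel x y) : X.self.DefinableMap Y.self (X.proj Y h) := by
  refine (congrArg _ (Set.ext fun p => ?_)).mp (Y.definable.inter
    (X.definable.preimage_comp (Sum.elim Sum.inl Sum.inl : Fin n ⊕ Fin n → Fin n ⊕ Fin n)))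
  constructor
  · rintro ⟨h₁, h₂⟩
    exact ⟨X.elem _ h₂, Y.elem _ (Y.trans (Y.symm h₁) h₁), ⟨h₂, rfl⟩, ⟨_, rfl⟩, Quotient.sound h₁⟩
  · rintro ⟨_, _, ⟨h₁, rfl⟩, ⟨h₂, rfl⟩, e⟩
    exact ⟨(Y.elem_eq_iff (h _ _ h₁) h₂).1 e, h₁⟩

namespace IsDimension

variable (hdim : IsDimension.{u, v, w} T dim)
  {M : Type w} [L.Structure M] [T.Model M] [Nonempty M] {n : ℕ} {X Y : InterpSet L M n}
include hdim

theorem zero_le_of_nonempty [Nonempty X.Elem] : 0 ≤ dim M X := by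
  obtain ⟨b⟩ := ‹Nonempty X.Elem›
  obtain ⟨F, hF, hF'⟩ := X.exists_fibre X id
    (by
      have := X.definableMap_proj X fun _ _ => id
      rwa [show X.proj X (fun _ _ => id) = id from funext fun a => Quotient.inductionOn a
        fun _ => rfl] at this) b
  have h : dim M F = 0 := by
    refine (hdim.eq_zero_iff M F).2 ⟨?_, ?_⟩
    · obtain ⟨⟨x, hx⟩, rfl⟩ := Quotient.exists_rep b
      exact ⟨F.elem x ((hF' x).2 ⟨hx, rfl⟩)⟩
    · have : Subsingleton F.Elem := by
        refine ⟨fun c d => ?_⟩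
        obtain ⟨⟨x, hx⟩, rfl⟩ := Quotient.exists_rep c
        obtain ⟨⟨y, hy⟩, rfl⟩ := Quotient.exists_rep d
        obtain ⟨hx', ex⟩ := (hF' x).1 hx
        obtain ⟨hy', ey⟩ := (hF' y).1 hy
        refine (F.elem_eq_iff hx hy).2 ((hF x y).2 ⟨?_, hx⟩)
        exact (X.elem_eq_iff hx' hy').1 (ex.trans ey.symm)
      infer_instance
  have h' := hdim.union M F X X hF (fun x y => ⟨fun h => ⟨h, X.trans h (X.symm h)⟩, fun h => h.1⟩)
    (fun x hx => Or.inr hx)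
  rw [h', h]
  exact le_max_left _ _

theorem one_le_of_infinite [Infinite X.Elem] : 1 ≤ dim M X := by
  have h := hdim.zero_le_of_nonempty (X := X)
  have h' : dim M X ≠ 0 := fun e => by
    have := ((hdim.eq_zero_iff M X).1 e).2
    exact not_finite X.Elem
  cases e : dim M X with
  | bot => rw [e] at h; exact absurd h (by simp)
  | coe k =>
    rw [e] at h'
    have : k ≠ 0 := by rintro rfl; exact h' rfl
    exact WithBot.one_le_coe.2 (Nat.one_le_iff_ne_zero.2 this)

/-- A coarser equivalence relation on the same set has smaller dimension: the projection has
nonempty fibres. -/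
theorem le_of_coarser (h : ∀ x y, X.rel x y → Y.rel x y) (h' : ∀ x, Y.dom x → X.dom x) :
    dim M Y ≤ dim M X := by
  have := hdim.fibre_ge M X Y (X.proj Y h) 0 (X.definableMap_proj Y h) (by
    intro b F hF hF'
    obtain ⟨⟨x, hx⟩, rfl⟩ := Quotient.exists_rep b
    have : Nonempty F.Elem := ⟨F.elem x ((hF' x).2 ⟨h' x hx, rfl⟩)⟩
    exact_mod_cast hdim.zero_le_of_nonempty)
  simpa using this

/-- The dimension drops when every class of a coarser equivalence relation contains infinitely
many classes of the finer one. -/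
theorem add_one_le_of_coarser (h : ∀ x y, X.rel x y → Y.rel x y)
    (h' : ∀ x, Y.dom x → ∃ z : ℕ → Fin n → M, (∀ i, X.dom (z i)) ∧ (∀ i, Y.rel x (z i)) ∧
      ∀ i j, i ≠ j → ¬ X.rel (z i) (z j)) :
    dim M Y + 1 ≤ dim M X := by
  refine hdim.fibre_ge M X Y (X.proj Y h) 1 (X.definableMap_proj Y h) ?_
  intro b F hF hF'
  obtain ⟨⟨x, hx⟩, rfl⟩ := Quotient.exists_rep b
  obtain ⟨z, hz₁, hz₂, hz₃⟩ := h' x hx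
  have hz : ∀ i, F.dom (z i) := fun i => (hF' _).2 ⟨hz₁ i, (Y.elem_eq_iff (h _ _ (hz₁ i)) hx).2
    (Y.symm (hz₂ i))⟩
  have : Infinite F.Elem := by
    refine Infinite.of_injective (fun i => F.elem (z i) (hz i)) fun i j e => ?_
    by_contra hij
    exact hz₃ i j hij ((hF _ _).1 ((F.elem_eq_iff _ _).1 e)).1
  exact_mod_cast hdim.one_le_of_infinite

end IsDimension

end Dimension

/-! ### Ultrapowers -/

section Ultrapower

open Filter

/-- The ultrapower of `M` along a nonprincipal ultrafilter on `ℕ`. -/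
abbrev Ultrapower (M : Type w) : Type w :=
  ((hyperfilter ℕ : Ultrafilter ℕ) : Filter ℕ).Product (fun _ : ℕ => M)

variable {L : FirstOrder.Language.{u, v}} {M : Type w} [L.Structure M]

/-- A tuple of sequences that represents a tuple of elements of the ultrapower, at index `n`. -/
noncomputable def Ultrapower.rep {α : Type*} (x : α → Ultrapower M) (n : ℕ) : α → M :=
  fun i => (x i).out n

/-- The tuple of elements of the ultrapower represented by a sequence of tuples. -/
noncomputable def Ultrapower.ofSeq {α : Type*} (s : ℕ → α → M) : α → Ultrapower M :=
  fun i => Quotient.mk _ (fun n => s n i)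

/-- The representatives of an element of the ultrapower are chosen arbitrarily, and agree with a
given sequence almost everywhere only. -/
theorem Ultrapower.rep_ofSeq {α : Type*} [Finite α] (s : ℕ → α → M) :
    ∀ᶠ n in hyperfilter ℕ, Ultrapower.rep (Ultrapower.ofSeq s) n = s n := by
  have h : ∀ i, ∀ᶠ n in hyperfilter ℕ, Ultrapower.rep (Ultrapower.ofSeq s) n i = s n i :=
    fun i => Quotient.mk_out (s := productSetoid (hyperfilter ℕ : Filter ℕ) (fun _ : ℕ => M))
      (fun n => s n i)
  filter_upwards [eventually_all.2 h] with n hn using funext hn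

variable [Nonempty M]

instance Ultrapower.model {T : L.Theory} [T.Model M] : T.Model (Ultrapower M) :=
  ⟨fun φ hφ => (Language.Ultraproduct.sentence_realize φ).2
    (Eventually.of_forall fun _ => Language.Theory.realize_sentence_of_mem T hφ)⟩

/-- Definable relations extend to definable relations on the ultrapower, and so do sequences of
relations that are defined by one formula with varying parameters. -/
theorem Ultrapower.definable_eventually {κ α : Type} {Z : Set (κ ⊕ α → M)}
    (hZ : (Set.univ : Set M).Definable L Z) (b : ℕ → κ → M) :
    (Set.univ : Set (Ultrapower M)).Definable L
      {x : α → Ultrapower M | ∀ᶠ n in hyperfilter ℕ, Sum.elim (b n) (rep x n) ∈ Z} := by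
  obtain ⟨φ, rfl⟩ := Set.definable_iff_exists_formula_sum.1 hZ
  refine Set.definable_iff_exists_formula_sum.2 ⟨φ.relabel (Sum.elim
    (fun m => Sum.inl ⟨(Quotient.mk _ fun _ => m.1 : Ultrapower M), trivial⟩)
    (Sum.elim (fun k => Sum.inl ⟨(Quotient.mk _ fun n => b n k : Ultrapower M), trivial⟩)
      Sum.inr)), ?_⟩
  ext x
  simp only [Set.mem_ofPred_eq, Language.Formula.realize_relabel]
  have h := Language.Ultraproduct.realize_formula_cast (u := hyperfilter ℕ) φ
    (fun i n => (Sum.elim (fun m => m.1) (Sum.elim (b n) (rep x n)) :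
      (Set.univ : Set M) ⊕ (κ ⊕ α) → M) i)
  refine h.symm.trans (iff_of_eq (congrArg _ (funext ?_)))
  rintro (m | k | i)
  · rfl
  · rfl
  · exact Quotient.out_eq (x i)

end Ultrapower

/-! ### Chains of uniformly definable equivalence relations -/

section Chains

open Filter

variable {L : FirstOrder.Language.{u, v}} {M : Type w} [L.Structure M] {X : Type*}

variable (L M) in
/-- A sequence of predicates is uniformly definable if all its members are defined by the same
formula, with varying parameters. -/
def UnifDef [Coding L M X] (p : ℕ → X → Prop) : Prop :=
  ∃ (κ : Type) (_ : Finite κ) (b : ℕ → κ → M) (Z : (κ → M) × X → Prop), IsDef L M Z ∧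
    ∀ n x, p n x ↔ Z (b n, x)

variable [Nonempty M] {a : ℕ}

/-- The equivalence relation on tuples of the ultrapower induced by a uniformly definable sequence
of equivalence relations. -/
noncomputable def Ultrapower.interpSet (P : ℕ → (Fin a → M) → (Fin a → M) → Prop)
    (hP : UnifDef L M (fun n (q : (Fin a → M) × (Fin a → M)) => P n q.1 q.2))
    (symm : ∀ n x y, P n x y → P n y x) (trans : ∀ n x y z, P n x y → P n y z → P n x z) :
    InterpSet L (Ultrapower M) a where
  rel x y := ∀ᶠ n in hyperfilter ℕ, P n (rep x n) (rep y n)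
  symm h := h.mono fun n => symm n _ _
  trans h h' := by filter_upwards [h, h'] with n using trans n _ _ _
  definable := by
    obtain ⟨κ, _, b, Z, hZ, h⟩ := hP
    refine (congrArg _ (Set.ext fun p => ?_)).mp (definable_eventually hZ b)
    refine eventually_congr (Eventually.of_forall fun n => ?_)
    refine Iff.trans ?_ (h n (_, _)).symm
    constructor
    · rintro ⟨⟨x, y, z⟩, ⟨rfl, rfl, rfl⟩, h⟩
      exact h
    · exact fun h => ⟨(b n, _, _), ⟨rfl, rfl, rfl⟩, h⟩

/-- The dimension drops along a pair of uniformly definable sequences of equivalence relations if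
the classes of the `n`-th coarser one contain at least `n` classes of the finer one. -/
theorem Ultrapower.add_one_le {T : L.Theory} [T.Model M]
    {dim : ∀ (M : Type w) [L.Structure M] [T.Model M] [Nonempty M] {n : ℕ},
      InterpSet L M n → WithBot ℕ} (hdim : IsDimension.{u, v, w} T dim)
    {P Q : ℕ → (Fin a → M) → (Fin a → M) → Prop} {hP hPs hPt hQ hQs hQt}
    (hPQ : ∀ n x y, P n x y → Q n x y)
    (h : ∀ n x, Q n x x → ∃ y : Fin n → Fin a → M, (∀ j, P n (y j) (y j)) ∧ (∀ j, Q n x (y j)) ∧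
      ∀ i j, i ≠ j → ¬ P n (y i) (y j)) :
    dim (Ultrapower M) (interpSet (L := L) Q hQ hQs hQt) + 1 ≤
      dim (Ultrapower M) (interpSet (L := L) P hP hPs hPt) := by
  classical
  refine hdim.add_one_le_of_coarser (fun x y h => h.mono fun n => hPQ n _ _) fun x hx => ?_
  choose y hy₁ hy₂ hy₃ using h
  -- For each `j` the `j`-th of the `n` classes exists from `n = j + 1` on; the point of the
  -- ultrapower that these classes define does not depend on the values at smaller `n`.
  let s : ℕ → ℕ → Fin a → M := fun j n =>
    if h : j < n ∧ Q n (rep x n) (rep x n) then y n _ h.2 ⟨j, h.1⟩ else rep x n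
  have hs : ∀ j, ∀ᶠ n in hyperfilter ℕ, ∃ (h : j < n) (h' : Q n (rep x n) (rep x n)),
      rep (ofSeq (s j)) n = y n _ h' ⟨j, h⟩ := by
    intro j
    have hj : ∀ᶠ n in hyperfilter ℕ, j < n :=
      Nat.hyperfilter_le_atTop (eventually_gt_atTop j)
    filter_upwards [rep_ofSeq (s j), hj, hx] with n h₁ h₂ h₃
    refine ⟨h₂, h₃, ?_⟩
    rw [h₁]
    exact dif_pos ⟨h₂, h₃⟩
  refine ⟨fun j => ofSeq (s j), fun j => ?_, fun j => ?_, fun i j hij h => ?_⟩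
  · refine (hs j).mono fun n => ?_
    rintro ⟨h₁, h₂, e⟩
    rw [e]
    exact hy₁ _ _ _ _
  · refine (hs j).mono fun n => ?_
    rintro ⟨h₁, h₂, e⟩
    rw [e]
    exact hy₂ _ _ _ _
  · obtain ⟨n, ⟨h₁, h₂, e⟩, ⟨h₁', h₂', e'⟩, h⟩ := ((hs i).and ((hs j).and h)).exists
    change P n _ _ at h
    rw [e, e'] at h
    exact hy₃ n _ _ _ _ (fun h => hij (by simpa using h)) h

end Chains

end FinDimLie

namespace FinDimLie

/-! ### Definable abelian groups -/

section DefAddGroup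

variable {L : FirstOrder.Language.{u, v}} {M : Type w} [L.Structure M] {X G : Type*}
  [Coding L M X] [AddCommGroup G] [Coding L M G]

variable (L M G) in
/-- The addition of the coded abelian group `G` is definable. -/
class DefAddGroup : Prop where
  add : IsDefMap L M (fun p : G × G => p.1 + p.2)

variable [DefAddGroup L M G] {f g : X → G}

@[fun_prop] theorem IsDefMap.add (hf : IsDefMap L M f) (hg : IsDefMap L M g) :
    IsDefMap L M (fun x => f x + g x) :=
  DefAddGroup.add.comp (hf.prodMk hg)

@[fun_prop] theorem IsDefMap.sub (hf : IsDefMap L M f) (hg : IsDefMap L M g) :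
    IsDefMap L M (fun x => f x - g x) := by
  have h : IsDef L M (fun q : X × G => q.2 + g q.1 = f q.1) :=
    IsDef.eq (by fun_prop) (by fun_prop)
  refine (congrArg (IsDef L M) (funext fun q => propext ?_)).mp h
  rw [sub_eq_iff_eq_add, eq_comm]

@[fun_prop] theorem IsDefMap.nsmul (n : ℕ) (hf : IsDefMap L M f) :
    IsDefMap L M (fun x => n • f x) := by
  induction n with
  | zero => simpa only [zero_smul] using IsDefMap.const (0 : G)
  | succ n ih => simpa only [succ_nsmul] using ih.add hf

theorem IsDef.mem_sup {H K : X → AddSubgroup G} (hH : IsDef L M (fun q : X × G => q.2 ∈ H q.1))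
    (hK : IsDef L M (fun q : X × G => q.2 ∈ K q.1)) :
    IsDef L M (fun q : X × G => q.2 ∈ H q.1 ⊔ K q.1) := by
  simp only [AddSubgroup.mem_sup]
  refine IsDef.exists (IsDef.and (hH.comp (f := fun r : (X × G) × G => (r.1.1, r.2))
    (by fun_prop)) (IsDef.exists (IsDef.and (hK.comp
      (f := fun r : ((X × G) × G) × G => (r.1.1.1, r.2)) (by fun_prop)) ?_)))
  exact IsDef.eq (by fun_prop) (by fun_prop)

end DefAddGroup

/-! ### Chains of definable subgroups -/

section Chains

variable {L : FirstOrder.Language.{u, v}} {M : Type w} [L.Structure M] [Nonempty M]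

omit [Nonempty M] in
theorem Coding.isDef_code {X : Type*} [C : Coding L M X] {κ : Type} [Finite κ] (σ : C.ι → κ) :
    IsDef L M (fun q : (κ → M) × X => C.Code (q.1 ∘ σ) q.2) := by
  refine IsDef.of_definable
    (C.definable.preimage_comp (Sum.map σ id : C.ι ⊕ C.ι → κ ⊕ C.ι)) fun c => ?_
  constructor
  · rintro ⟨x, h, h'⟩
    exact ⟨(c ∘ Sum.inl, x), ⟨rfl, h'⟩, h⟩
  · rintro ⟨⟨_, x⟩, ⟨rfl, h'⟩, h⟩
    exact ⟨x, h, h'⟩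

/-- The structure `M` is a model of a finite-dimensional theory. -/
class FinDimModel (L : FirstOrder.Language.{u, v}) (M : Type w) [L.Structure M] : Prop where
  exists_theory : ∃ T : L.Theory, IsFiniteDimensional.{u, v, w} T ∧ T.Model M

section UnifDef

variable {X Y G : Type*} [Coding L M X] [Coding L M Y]

omit [Nonempty M] in
theorem UnifDef.of_isDef {p : X → Prop} (h : IsDef L M p) : UnifDef L M (fun _ => p) :=
  ⟨Empty, inferInstance, fun _ => Empty.elim, fun q => p q.2, h.comp .snd, fun _ _ => Iff.rfl⟩

omit [Nonempty M] in
/-- A sequence of members of a definable family is uniformly definable. -/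
theorem UnifDef.of_family {p : Y → X → Prop} (h : IsDef L M (fun q : Y × X => p q.1 q.2))
    (y : ℕ → Y) : UnifDef L M (fun n => p (y n)) := by
  choose c hc using fun n => Coding.exists_code (L := L) (M := M) (y n)
  refine ⟨Coding.ι L M Y, inferInstance, c, fun q => ∃ z, Coding.Code (L := L) q.1 z ∧ p z q.2,
    ?_, fun n x => ?_⟩
  · refine IsDef.exists (IsDef.and ((Coding.isDef_code id).comp
      (f := fun r : ((Coding.ι L M Y → M) × X) × Y => (r.1.1, r.2)) (by fun_prop))
      (h.comp (f := fun r : ((Coding.ι L M Y → M) × X) × Y => (r.2, r.1.2)) (by fun_prop)))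
  · constructor
    · exact fun h => ⟨y n, hc n, h⟩
    · rintro ⟨z, hz, h⟩
      rwa [Coding.unique (hc n) hz]

omit [Nonempty M] in
/-- Two uniformly definable sequences have a common sequence of parameters. -/
theorem UnifDef.common {p : ℕ → X → Prop} {q : ℕ → Y → Prop} (hp : UnifDef L M p)
    (hq : UnifDef L M q) : ∃ (κ : Type) (_ : Finite κ) (b : ℕ → κ → M)
      (Z : (κ → M) × X → Prop) (Z' : (κ → M) × Y → Prop), IsDef L M Z ∧ IsDef L M Z' ∧
      (∀ n x, p n x ↔ Z (b n, x)) ∧ ∀ n x, q n x ↔ Z' (b n, x) := by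
  obtain ⟨κ, _, b, Z, hZ, h⟩ := hp
  obtain ⟨κ', _, b', Z', hZ', h'⟩ := hq
  have h₁ : IsDefMap L M (fun c : κ ⊕ κ' → M => c ∘ Sum.inl) :=
    IsReindexing.isDefMap ⟨Sum.inl, fun c x (h : c = x) => by subst h; rfl⟩
  have h₂ : IsDefMap L M (fun c : κ ⊕ κ' → M => c ∘ Sum.inr) :=
    IsReindexing.isDefMap ⟨Sum.inr, fun c x (h : c = x) => by subst h; rfl⟩
  exact ⟨κ ⊕ κ', inferInstance, fun n => Sum.elim (b n) (b' n),
    fun q => Z (q.1 ∘ Sum.inl, q.2), fun q => Z' (q.1 ∘ Sum.inr, q.2),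
    hZ.comp ((h₁.comp .fst).prodMk .snd), hZ'.comp ((h₂.comp .fst).prodMk .snd), h, h'⟩

omit [Nonempty M] in
theorem UnifDef.and {p q : ℕ → X → Prop} (hp : UnifDef L M p) (hq : UnifDef L M q) :
    UnifDef L M (fun n x => p n x ∧ q n x) := by
  obtain ⟨κ, _, b, Z, Z', hZ, hZ', h, h'⟩ := hp.common hq
  exact ⟨κ, inferInstance, b, _, hZ.and hZ', fun n x => and_congr (h n x) (h' n x)⟩

variable [AddCommGroup G] [Coding L M G] [DefAddGroup L M G]

omit [Nonempty M] in
theorem UnifDef.sup {H K : ℕ → AddSubgroup G} (hH : UnifDef L M (fun n g => g ∈ H n))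
    (hK : UnifDef L M (fun n g => g ∈ K n)) : UnifDef L M (fun n g => g ∈ H n ⊔ K n) := by
  obtain ⟨κ, _, b, Z, Z', hZ, hZ', h, h'⟩ := hH.common hK
  refine ⟨κ, inferInstance, b, fun q => ∃ x, Z (q.1, x) ∧ ∃ y, Z' (q.1, y) ∧ x + y = q.2,
    ?_, fun n g => ?_⟩
  · refine IsDef.exists (IsDef.and (hZ.comp
      (f := fun r : ((κ → M) × G) × G => (r.1.1, r.2)) (by fun_prop)) (IsDef.exists (IsDef.and
        (hZ'.comp (f := fun r : (((κ → M) × G) × G) × G => (r.1.1.1, r.2)) (by fun_prop)) ?_)))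
    exact IsDef.eq (by fun_prop) (by fun_prop)
  · simp only [AddSubgroup.mem_sup, h, h']

/-- The relation between codes of belonging to the same coset of a subgroup. -/
def cosetRel (L : FirstOrder.Language.{u, v}) {M : Type w} [L.Structure M] [C : Coding L M G]
    {a : ℕ} (e : C.ι ≃ Fin a) (H : AddSubgroup G) (x y : Fin a → M) : Prop :=
  ∃ g h, C.Code (x ∘ e) g ∧ C.Code (y ∘ e) h ∧ g - h ∈ H

omit [Nonempty M] [DefAddGroup L M G] in
theorem cosetRel.symm {a : ℕ} {e : Coding.ι L M G ≃ Fin a} {H : AddSubgroup G} {x y : Fin a → M} :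
    cosetRel L e H x y → cosetRel L e H y x := by
  rintro ⟨g, h, hg, hh, hgh⟩
  exact ⟨h, g, hh, hg, by simpa using neg_mem hgh⟩

omit [Nonempty M] [DefAddGroup L M G] in
theorem cosetRel.trans {a : ℕ} {e : Coding.ι L M G ≃ Fin a} {H : AddSubgroup G}
    {x y z : Fin a → M} : cosetRel L e H x y → cosetRel L e H y z → cosetRel L e H x z := by
  rintro ⟨g, h, hg, hh, hgh⟩ ⟨h', k, hh', hk, hhk⟩
  obtain rfl := Coding.unique hh hh'
  exact ⟨g, k, hg, hk, by simpa using add_mem hgh hhk⟩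

omit [Nonempty M] in
theorem UnifDef.cosetRel {a : ℕ} (e : Coding.ι L M G ≃ Fin a) {H : ℕ → AddSubgroup G}
    (hH : UnifDef L M (fun n g => g ∈ H n)) :
    UnifDef L M (fun n (q : (Fin a → M) × (Fin a → M)) => cosetRel L e (H n) q.1 q.2) := by
  obtain ⟨κ, _, b, Z, hZ, h⟩ := hH
  refine ⟨κ, inferInstance, b, fun q => ∃ g h, Coding.Code (L := L) (q.2.1 ∘ e) g ∧
    Coding.Code (L := L) (q.2.2 ∘ e) h ∧ Z (q.1, g - h), ?_, fun n q => ?_⟩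
  · refine IsDef.exists (IsDef.exists (IsDef.and ?_ (IsDef.and ?_ ?_)))
    · exact (Coding.isDef_code e).comp (f := fun r : (((κ → M) × ((Fin a → M) × (Fin a → M))) × G)
        × G => (r.1.1.2.1, r.1.2)) (by fun_prop)
    · exact (Coding.isDef_code e).comp (f := fun r : (((κ → M) × ((Fin a → M) × (Fin a → M))) × G)
        × G => (r.1.1.2.2, r.2)) (by fun_prop)
    · exact hZ.comp (f := fun r : (((κ → M) × ((Fin a → M) × (Fin a → M))) × G)
        × G => (r.1.1.1, r.1.2 - r.2)) (by fun_prop)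
  · simp only [FinDimLie.cosetRel, h]

end UnifDef

section Group

variable {G : Type*} [AddCommGroup G]

/-- As `relIndex` is `0` for infinite indices, the hypothesis says that the index is at least `n`.
-/
theorem exists_fin_of_relIndex {H K : AddSubgroup G} {n : ℕ}
    (h : H.relIndex K = 0 ∨ n ≤ H.relIndex K) :
    ∃ t : Fin n → G, (∀ j, t j ∈ K) ∧ ∀ i j, i ≠ j → t i - t j ∉ H := by
  have : ∃ t : Fin n → K ⧸ H.addSubgroupOf K, Function.Injective t := by
    by_cases hf : Finite (K ⧸ H.addSubgroupOf K)
    · have h' : n ≤ Nat.card (K ⧸ H.addSubgroupOf K) :=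
        h.resolve_left (Nat.card_pos (α := K ⧸ H.addSubgroupOf K)).ne'
      exact ⟨_, ((Finite.equivFin _).symm.injective.comp (Fin.castLE_injective h'))⟩
    · rw [not_finite_iff_infinite] at hf
      exact ⟨_, (Infinite.natEmbedding (K ⧸ H.addSubgroupOf K)).injective.comp Fin.val_injective⟩
  obtain ⟨t, ht⟩ := this
  refine ⟨fun j => ((t j).out : K), fun j => ((t j).out : K).2, fun i j hij h => hij (ht ?_)⟩
  rw [← (t i).out_eq', ← (t j).out_eq']
  refine (QuotientAddGroup.eq (s := H.addSubgroupOf K)).2 ?_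
  rw [AddSubgroup.mem_addSubgroupOf]
  have := neg_mem h
  rw [neg_sub] at this
  simpa [sub_eq_neg_add] using this

variable [Coding L M G] [DefAddGroup L M G]

variable (L M G) in
/-- A uniformly definable sequence `H` of subgroups of `G` defines a subgroup of the ultrapower of
`G`; the dimension `D H` of the quotient by it is antitone in `H`, and strictly so between
sequences whose indices tend to infinity. -/
theorem exists_codim [FinDimModel L M] :
    ∃ D : {H : ℕ → AddSubgroup G // UnifDef L M (fun n g => g ∈ H n)} → ℕ,
      (∀ H K, (∀ n, H.1 n ≤ K.1 n) → D K ≤ D H) ∧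
      ∀ H K, (∀ n, H.1 n ≤ K.1 n) → (∀ n, (H.1 n).relIndex (K.1 n) = 0 ∨
        n ≤ (H.1 n).relIndex (K.1 n)) → D K + 1 ≤ D H := by
  obtain ⟨T, ⟨dim, hdim⟩, hT⟩ := FinDimModel.exists_theory (L := L) (M := M)
  obtain ⟨a, ⟨e⟩⟩ := Finite.exists_equiv_fin (Coding.ι L M G)
  let I : {H : ℕ → AddSubgroup G // UnifDef L M (fun n g => g ∈ H n)} →
      InterpSet L (Ultrapower M) a := fun H =>
    Ultrapower.interpSet (fun n => cosetRel L e (H.1 n)) (H.2.cosetRel e)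
      (fun n _ _ => cosetRel.symm) (fun n _ _ _ => cosetRel.trans)
  have h0 : ∀ H, ∃ d : ℕ, dim (Ultrapower M) (I H) = d := by
    intro H
    obtain ⟨c, hc⟩ := Coding.exists_code (L := L) (M := M) (0 : G)
    have : Nonempty (I H).Elem := by
      refine ⟨(I H).elem (Ultrapower.ofSeq fun _ => c ∘ e.symm) ?_⟩
      refine (Ultrapower.rep_ofSeq fun _ => c ∘ e.symm).mono fun n hn => ?_
      rw [hn]
      refine ⟨0, 0, ?_, ?_, by simp⟩ <;> simpa [Function.comp_assoc] using hc
    have := hdim.zero_le_of_nonempty (X := I H)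
    cases h : dim (Ultrapower M) (I H) with
    | bot => rw [h] at this; exact absurd this (by simp)
    | coe d => exact ⟨d, rfl⟩
  choose D hD using h0
  have hmono : ∀ H K : {H : ℕ → AddSubgroup G // UnifDef L M (fun n g => g ∈ H n)},
      (∀ n, H.1 n ≤ K.1 n) → ∀ n x y, cosetRel L e (H.1 n) x y → cosetRel L e (K.1 n) x y := by
    rintro H K hHK n x y ⟨g, h, hg, hh, hgh⟩
    exact ⟨g, h, hg, hh, hHK n hgh⟩
  refine ⟨D, fun H K hHK => ?_, fun H K hHK h => ?_⟩
  · have : dim (Ultrapower M) (I K) ≤ dim (Ultrapower M) (I H) := by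
      refine hdim.le_of_coarser (fun x y h => h.mono fun n => hmono H K hHK n _ _)
        fun x hx => hx.mono ?_
      rintro n ⟨g, _, hg, -⟩
      exact ⟨g, g, hg, hg, by simp⟩
    rw [hD, hD] at this
    exact_mod_cast this
  · have : dim (Ultrapower M) (I K) + 1 ≤ dim (Ultrapower M) (I H) := by
      refine Ultrapower.add_one_le hdim (hmono H K hHK) ?_
      rintro n x ⟨g, _, hg, -⟩
      obtain ⟨t, ht, ht'⟩ := exists_fin_of_relIndex (h n)
      choose y hy using fun j => Coding.exists_code (L := L) (M := M) (g + t j)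
      have hy' : ∀ j, Coding.Code (L := L) ((y j ∘ e.symm) ∘ e) (g + t j) := fun j => by
        simpa [Function.comp_assoc] using hy j
      refine ⟨fun j => y j ∘ e.symm, fun j => ⟨_, _, hy' j, hy' j, by simp⟩,
        fun j => ⟨_, _, hg, hy' j, by simpa using ht j⟩, ?_⟩
      rintro i j hij ⟨_, _, h₁, h₂, h₃⟩
      rw [← Coding.unique (hy' i) h₁, ← Coding.unique (hy' j) h₂, add_sub_add_left_eq_sub] at h₃
      exact ht' i j hij h₃
    rw [hD, hD] at this
    exact_mod_cast this

variable [FinDimModel L M]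

/-- There is no increasing chain of uniformly definable sequences of subgroups whose successive
indices tend to infinity. -/
theorem not_exists_increasing (W : ℕ → ℕ → AddSubgroup G)
    (hW : ∀ i, UnifDef L M (fun n g => g ∈ W i n)) (hle : ∀ i n, W i n ≤ W (i + 1) n)
    (h : ∀ i n, (W i n).relIndex (W (i + 1) n) = 0 ∨ n ≤ (W i n).relIndex (W (i + 1) n)) :
    False := by
  obtain ⟨D, -, hD⟩ := exists_codim L M G
  -- `D` decreases strictly along the chain, whatever its starting point.
  have h' : ∀ k i, k ≤ D ⟨W i, hW i⟩ := by
    intro k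
    induction k with
    | zero => exact fun i => Nat.zero_le _
    | succ k ih =>
      exact fun i => (Nat.succ_le_succ (ih (i + 1))).trans
        (hD ⟨W i, hW i⟩ ⟨W (i + 1), hW (i + 1)⟩ (hle i) (h i))
  exact absurd (h' _ 0) (Nat.not_succ_le_self _)

/-- There is no decreasing chain of uniformly definable sequences of subgroups whose successive
indices tend to infinity. -/
theorem not_exists_decreasing (W : ℕ → ℕ → AddSubgroup G)
    (hW : ∀ i, UnifDef L M (fun n g => g ∈ W i n)) (hle : ∀ i n, W (i + 1) n ≤ W i n)
    (h : ∀ i n, (W (i + 1) n).relIndex (W i n) = 0 ∨ n ≤ (W (i + 1) n).relIndex (W i n)) :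
    False := by
  obtain ⟨D, hD', hD⟩ := exists_codim L M G
  -- `D` increases strictly along the chain, but is bounded by its value at the zero subgroup.
  have h' : ∀ k, k ≤ D ⟨W k, hW k⟩ := by
    intro k
    induction k with
    | zero => exact Nat.zero_le _
    | succ k ih =>
      exact (Nat.succ_le_succ ih).trans (hD ⟨W (k + 1), hW (k + 1)⟩ ⟨W k, hW k⟩ (hle k) (h k))
  let B : {H : ℕ → AddSubgroup G // UnifDef L M (fun n g => g ∈ H n)} :=
    ⟨fun _ => ⊥, UnifDef.of_isDef (by simpa using IsDef.eq_const (0 : G))⟩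
  exact absurd ((h' _).trans (hD' B ⟨W (D B + 1), hW _⟩ fun n => bot_le)) (Nat.not_succ_le_self _)

/-- A definable injective endomorphism has a range of finite index: otherwise the ranges of its
powers form a decreasing chain whose successive indices are infinite. -/
theorem finiteIndex_range_of_injective (f : AddMonoid.End G) (hf : IsDefMap L M f)
    (hf' : Function.Injective f) : (AddMonoidHom.range f).FiniteIndex := by
  by_contra hr
  have hidx : (AddMonoidHom.range f).index = 0 := by
    by_contra h
    exact hr ⟨h⟩
  have hpow : ∀ i : ℕ, IsDefMap L M (f ^ i) := by
    intro i
    induction i with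
    | zero => exact IsDefMap.id
    | succ i ih => rw [pow_succ]; exact ih.comp hf
  have hinj : ∀ i : ℕ, Function.Injective (f ^ i) := by
    intro i
    induction i with
    | zero => exact Function.injective_id
    | succ i ih => rw [pow_succ]; exact ih.comp hf'
  have hmap : ∀ i : ℕ, AddMonoidHom.range (f ^ (i + 1)) =
      (AddMonoidHom.range f).map (f ^ i : AddMonoid.End G) := by
    intro i
    rw [pow_succ]
    exact AddMonoidHom.range_comp (f ^ i : AddMonoid.End G) f
  refine not_exists_decreasing (L := L) (M := M) (fun i _ => AddMonoidHom.range (f ^ i))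
    (fun i => UnifDef.of_isDef ?_) (fun i _ => ?_) (fun i n => Or.inl ?_)
  · have h := (IsDef.true (X := G)).image (hpow i)
    simp only [true_and] at h
    exact h
  · rw [hmap]
    exact AddSubgroup.map_le_range _ _
  · rw [hmap, show AddMonoidHom.range (f ^ i) = (⊤ : AddSubgroup G).map (f ^ i : AddMonoid.End G)
      from AddMonoidHom.range_eq_map _]
    exact (AddSubgroup.relIndex_map_map_of_injective _ _ (hinj i)).trans
      ((AddSubgroup.relIndex_top_right _).trans hidx)

end Group

end Chains

/-! ### Inclusion of subgroups up to an integer multiple -/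

section AlmostLE

variable {G : Type*} [AddCommGroup G]

/-- `H` is almost contained in `K` if some multiple of `H` by a positive integer is contained
in `K`. -/
def AlmostLE (H K : AddSubgroup G) : Prop := ∃ c : ℕ, 0 < c ∧ ∀ h ∈ H, c • h ∈ K

theorem AlmostLE.of_le {H K : AddSubgroup G} (h : H ≤ K) : AlmostLE H K :=
  ⟨1, one_pos, fun x hx => by simpa using h hx⟩

theorem AlmostLE.trans {H K N : AddSubgroup G} (h : AlmostLE H K) (h' : AlmostLE K N) :
    AlmostLE H N := by
  obtain ⟨c, hc, h⟩ := h
  obtain ⟨d, hd, h'⟩ := h'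
  exact ⟨d * c, mul_pos hd hc, fun x hx => by rw [mul_smul]; exact h' _ (h x hx)⟩

theorem AlmostLE.inf {H K N : AddSubgroup G} (h : AlmostLE H K) (h' : AlmostLE H N) :
    AlmostLE H (K ⊓ N) := by
  obtain ⟨c, hc, h⟩ := h
  obtain ⟨d, hd, h'⟩ := h'
  refine ⟨d * c, mul_pos hd hc, fun x hx => ⟨?_, ?_⟩⟩
  · rw [mul_smul]; exact nsmul_mem (h x hx) d
  · rw [mul_comm, mul_smul]; exact nsmul_mem (h' x hx) c

theorem AlmostLE.sup {H K N : AddSubgroup G} (h : AlmostLE H N) (h' : AlmostLE K N) :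
    AlmostLE (H ⊔ K) N := by
  obtain ⟨c, hc, h⟩ := h
  obtain ⟨d, hd, h'⟩ := h'
  refine ⟨d * c, mul_pos hd hc, fun x hx => ?_⟩
  obtain ⟨y, hy, z, hz, rfl⟩ := AddSubgroup.mem_sup.1 hx
  rw [smul_add]
  refine add_mem ?_ ?_
  · rw [mul_smul]; exact nsmul_mem (h y hy) d
  · rw [mul_comm, mul_smul]; exact nsmul_mem (h' z hz) c

theorem almostLE_of_relIndex_ne_zero {H K : AddSubgroup G} (h : H.relIndex K ≠ 0) :
    AlmostLE K H :=
  ⟨(H.relIndex K).factorial, Nat.factorial_pos _, fun _ hx =>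
    (AddSubgroup.nsmul_mem_of_relIndex_ne_zero_of_dvd h hx fun _ h₁ h₂ =>
      Nat.dvd_factorial h₁ h₂).1⟩

theorem almostLE_of_finiteIndex {H : AddSubgroup G} (h : H.FiniteIndex) : AlmostLE ⊤ H :=
  almostLE_of_relIndex_ne_zero (by rw [AddSubgroup.relIndex_top_right]; exact h.index_ne_zero)

theorem almostLE_bot_of_finite {H : AddSubgroup G} (h : (H : Set G).Finite) : AlmostLE H ⊥ := by
  have : Finite H := h
  exact almostLE_of_relIndex_ne_zero (by
    rw [AddSubgroup.relIndex_bot_left]; exact Nat.card_pos.ne')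

/-- If `n!` times some element of `K` is not in `H`, the index of `H` in `K` is infinite or at
least `n`. -/
theorem relIndex_eq_zero_or_le {H K : AddSubgroup G} {n : ℕ} {x : G} (hx : x ∈ K)
    (hx' : n.factorial • x ∉ H) : H.relIndex K = 0 ∨ n ≤ H.relIndex K := by
  by_contra! h
  exact hx' (AddSubgroup.nsmul_mem_of_relIndex_ne_zero_of_dvd h.1 hx fun _ h₁ h₂ =>
    Nat.dvd_factorial h₁ (h₂.trans h.2.le)).1

variable {L : FirstOrder.Language.{u, v}} {M : Type w} [L.Structure M] [Nonempty M]
  [FinDimModel L M] [Coding L M G] [DefAddGroup L M G]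

variable (L M) in
/-- Ascending chain condition for definable subgroups, up to integer multiples. -/
theorem exists_maximal_almostLE (P : AddSubgroup G → Prop) (hP : ∃ H, P H)
    (hdef : ∀ H, P H → IsDef L M (· ∈ H)) :
    ∃ H, P H ∧ ∀ K, P K → H ≤ K → AlmostLE K H := by
  by_contra! h
  obtain ⟨H₀, h₀⟩ := hP
  choose f hf using h
  let s : ℕ → {H // P H} := fun i => Nat.rec ⟨H₀, h₀⟩ (fun _ H => ⟨f H.1 H.2, (hf H.1 H.2).1⟩) i
  refine not_exists_increasing (L := L) (M := M) (fun i _ => (s i).1)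
    (fun i => UnifDef.of_isDef (hdef _ (s i).2)) (fun i _ => (hf (s i).1 (s i).2).2.1)
    (fun i _ => Or.inl ?_)
  by_contra h
  exact (hf (s i).1 (s i).2).2.2 (almostLE_of_relIndex_ne_zero h)

variable (L M) in
/-- Descending chain condition for definable subgroups, up to integer multiples. -/
theorem exists_minimal_almostLE (P : AddSubgroup G → Prop) (hP : ∃ H, P H)
    (hdef : ∀ H, P H → IsDef L M (· ∈ H)) :
    ∃ H, P H ∧ ∀ K, P K → K ≤ H → AlmostLE H K := by
  by_contra! h
  obtain ⟨H₀, h₀⟩ := hP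
  choose f hf using h
  let s : ℕ → {H // P H} := fun i => Nat.rec ⟨H₀, h₀⟩ (fun _ H => ⟨f H.1 H.2, (hf H.1 H.2).1⟩) i
  refine not_exists_decreasing (L := L) (M := M) (fun i _ => (s i).1)
    (fun i => UnifDef.of_isDef (hdef _ (s i).2)) (fun i _ => (hf (s i).1 (s i).2).2.1)
    (fun i _ => Or.inl ?_)
  by_contra h
  exact (hf (s i).1 (s i).2).2.2 (almostLE_of_relIndex_ne_zero h)

variable {B : Type*} [Coding L M B]

/-- The members of a definable family of subgroups that almost contain `S` contain the same multiple
of `S`: otherwise one intersects, for every `n`, members for which `n!` does not work, and the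
chains so obtained have successive indices at least `n`. -/
theorem exists_nsmul_mem_of_almostLE {W : B → AddSubgroup G}
    (hW : IsDef L M (fun q : B × G => q.2 ∈ W q.1)) {S : AddSubgroup G}
    (hS : IsDef L M (· ∈ S)) :
    ∃ N : ℕ, 0 < N ∧ ∀ b, AlmostLE S (W b) → ∀ s ∈ S, N • s ∈ W b := by
  by_contra! h
  have key : ∀ (n : ℕ) (H : {H : AddSubgroup G // AlmostLE S H}), ∃ b, AlmostLE S (W b) ∧
      ∃ x ∈ H.1, n.factorial • x ∉ W b := by
    rintro n ⟨H, c, hc, hH⟩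
    obtain ⟨b, hb, s, hs, hs'⟩ := h (n.factorial * c) (mul_pos n.factorial_pos hc)
    exact ⟨b, hb, c • s, hH s hs, by rwa [← mul_smul]⟩
  choose β hβ hβ' using key
  let st : ℕ → ℕ → {H : AddSubgroup G // AlmostLE S H} := fun n i =>
    Nat.rec ⟨S, .of_le le_rfl⟩ (fun _ H => ⟨H.1 ⊓ W (β n H), H.2.inf (hβ n H)⟩) i
  refine not_exists_decreasing (L := L) (M := M) (fun i n => (st n i).1) (fun i => ?_)
    (fun i n => inf_le_left) (fun i n => ?_)
  · induction i with
    | zero => exact UnifDef.of_isDef hS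
    | succ i ih => exact ih.and (UnifDef.of_family (p := fun b g => g ∈ W b) hW _)
  · obtain ⟨x, hx, hx'⟩ := hβ' n (st n i)
    exact relIndex_eq_zero_or_le hx fun h => hx' h.2

/-- The members of bounded exponent of a definable family of subgroups have a common exponent: the
argument is dual, with sums in place of intersections. -/
theorem exists_nsmul_eq_zero_of_almostLE {W : B → AddSubgroup G}
    (hW : IsDef L M (fun q : B × G => q.2 ∈ W q.1)) :
    ∃ N : ℕ, 0 < N ∧ ∀ b, AlmostLE (W b) ⊥ → ∀ g ∈ W b, N • g = 0 := by
  by_contra! h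
  have key : ∀ (n : ℕ) (H : {H : AddSubgroup G // AlmostLE H ⊥}), ∃ b, AlmostLE (W b) ⊥ ∧
      ∃ x ∈ W b, n.factorial • x ∉ H.1 := by
    rintro n ⟨H, c, hc, hH⟩
    obtain ⟨b, hb, s, hs, hs'⟩ := h (c * n.factorial) (mul_pos hc n.factorial_pos)
    refine ⟨b, hb, s, hs, fun hmem => hs' ?_⟩
    rw [mul_smul]
    exact AddSubgroup.mem_bot.1 (hH _ hmem)
  choose β hβ hβ' using key
  let st : ℕ → ℕ → {H : AddSubgroup G // AlmostLE H ⊥} := fun n i =>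
    Nat.rec ⟨⊥, .of_le le_rfl⟩ (fun _ H => ⟨H.1 ⊔ W (β n H), H.2.sup (hβ n H)⟩) i
  refine not_exists_increasing (L := L) (M := M) (fun i n => (st n i).1) (fun i => ?_)
    (fun i n => le_sup_left) (fun i n => ?_)
  · induction i with
    | zero => exact UnifDef.of_isDef (by simpa [st] using IsDef.eq_const (0 : G))
    | succ i ih => exact ih.sup (UnifDef.of_family (p := fun b g => g ∈ W b) hW _)
  · obtain ⟨x, hx, hx'⟩ := hβ' n (st n i)
    exact relIndex_eq_zero_or_le (AddSubgroup.mem_sup_right (S := (st n i).1) hx) hx'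

end AlmostLE

end FinDimLie

namespace FinDimLie

/-! ### Orbits under sums of monomials -/

section Action

variable {A V : Type*} [AddCommGroup A] [AddCommGroup V] (ρ : A →+ AddMonoid.End V)

/-- For a list `τ = [m₁, …, mᵣ]`, the group of the endomorphisms `m₁ ρ(x₁) + ⋯ + mᵣ ρ(xᵣ)`. -/
def actSpan : List (AddMonoid.End V) → AddSubgroup (AddMonoid.End V)
  | [] => ⊥
  | m :: τ => ((AddMonoidHom.mulLeft m).comp ρ).range ⊔ actSpan τ

/-- The group of the `γ v` with `γ` in `actSpan ρ τ`. -/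
def orbit (τ : List (AddMonoid.End V)) (a : V) : AddSubgroup V where
  carrier := {b | ∃ γ ∈ actSpan ρ τ, γ a = b}
  zero_mem' := ⟨0, zero_mem _, rfl⟩
  add_mem' := by
    rintro _ _ ⟨γ, hγ, rfl⟩ ⟨δ, hδ, rfl⟩
    exact ⟨γ + δ, add_mem hγ hδ, rfl⟩
  neg_mem' := by
    rintro _ ⟨γ, hγ, rfl⟩
    exact ⟨-γ, neg_mem hγ, rfl⟩

/-- A subgroup `W` is almost invariant if some positive multiple of the action maps it to itself. -/
def AlmostInvariant (W : AddSubgroup V) : Prop :=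
  ∃ n : ℕ, 0 < n ∧ ∀ x, ∀ a ∈ W, n • ρ x a ∈ W

variable {ρ}

theorem end_mul_apply (m m' : AddMonoid.End V) (a : V) : (m * m') a = m (m' a) := rfl

theorem end_add_apply (m m' : AddMonoid.End V) (a : V) : (m + m') a = m a + m' a := rfl

theorem mem_orbit {τ : List (AddMonoid.End V)} {a b : V} :
    b ∈ orbit ρ τ a ↔ ∃ γ ∈ actSpan ρ τ, γ a = b := Iff.rfl

theorem mem_actSpan_cons {m γ : AddMonoid.End V} {τ : List (AddMonoid.End V)} :
    γ ∈ actSpan ρ (m :: τ) ↔ ∃ x, ∃ δ ∈ actSpan ρ τ, m * ρ x + δ = γ := by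
  rw [actSpan, AddSubgroup.mem_sup]
  constructor
  · rintro ⟨_, ⟨x, rfl⟩, δ, hδ, rfl⟩
    exact ⟨x, δ, hδ, rfl⟩
  · rintro ⟨x, δ, hδ, rfl⟩
    exact ⟨_, ⟨x, rfl⟩, δ, hδ, rfl⟩

theorem actSpan_le_append_right (τ τ' : List (AddMonoid.End V)) :
    actSpan ρ τ ≤ actSpan ρ (τ' ++ τ) := by
  induction τ' with
  | nil => exact le_rfl
  | cons m τ' ih => exact ih.trans le_sup_right

theorem actSpan_le_append_left (τ τ' : List (AddMonoid.End V)) :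
    actSpan ρ τ' ≤ actSpan ρ (τ' ++ τ) := by
  induction τ' with
  | nil => exact bot_le
  | cons m τ' ih => exact sup_le_sup_left ih _

theorem mul_mem_actSpan {τ : List (AddMonoid.End V)} {γ : AddMonoid.End V}
    (hγ : γ ∈ actSpan ρ τ) (m : AddMonoid.End V) : m * γ ∈ actSpan ρ (τ.map (m * ·)) := by
  induction τ generalizing γ with
  | nil =>
    rw [AddSubgroup.mem_bot.1 hγ, mul_zero]
    exact zero_mem _
  | cons m' τ ih =>
    obtain ⟨x, δ, hδ, rfl⟩ := mem_actSpan_cons.1 hγ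
    exact mem_actSpan_cons.2 ⟨x, m * δ, ih hδ, by rw [mul_add, mul_assoc]⟩

theorem mul_ρ_mem_actSpan {τ : List (AddMonoid.End V)} {m : AddMonoid.End V} (hm : m ∈ τ) (x : A) :
    m * ρ x ∈ actSpan ρ τ := by
  induction τ with
  | nil => simp at hm
  | cons m' τ ih =>
    rcases List.mem_cons.1 hm with rfl | h
    · exact mem_actSpan_cons.2 ⟨x, 0, zero_mem _, add_zero _⟩
    · exact mem_actSpan_cons.2 ⟨0, _, ih h, by rw [map_zero, mul_zero, zero_add]⟩

theorem orbit_le_append_right (τ τ' : List (AddMonoid.End V)) (a : V) :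
    orbit ρ τ a ≤ orbit ρ (τ' ++ τ) a := by
  rintro _ ⟨γ, hγ, rfl⟩
  exact ⟨γ, actSpan_le_append_right τ τ' hγ, rfl⟩

theorem nsmul_mem_orbit {τ : List (AddMonoid.End V)} {a b : V} (n : ℕ) (h : b ∈ orbit ρ τ a) :
    n • b ∈ orbit ρ τ (n • a) := by
  obtain ⟨γ, hγ, rfl⟩ := h
  exact ⟨γ, hγ, map_nsmul γ n a⟩

theorem exists_of_mem_orbit_nsmul {τ : List (AddMonoid.End V)} {a b : V} {n : ℕ}
    (h : b ∈ orbit ρ τ (n • a)) : ∃ c ∈ orbit ρ τ a, n • c = b := by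
  obtain ⟨γ, hγ, rfl⟩ := h
  exact ⟨γ a, ⟨γ, hγ, rfl⟩, (map_nsmul γ n a).symm⟩

/-- Monomials in the action preserve an almost invariant subgroup up to a multiple. -/
theorem AlmostInvariant.exists_nsmul_mem {W : AddSubgroup V} (hW : AlmostInvariant ρ W)
    {τ : List (AddMonoid.End V)} (hτ : ∀ m ∈ τ, m ∈ Submonoid.closure (Set.range ρ)) :
    ∃ n : ℕ, 0 < n ∧ ∀ a ∈ W, ∀ γ ∈ actSpan ρ τ, n • γ a ∈ W := by
  obtain ⟨k, hk, hkW⟩ := hW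
  have hmon : ∀ m ∈ Submonoid.closure (Set.range ρ), ∃ n : ℕ, 0 < n ∧ ∀ a ∈ W, n • m a ∈ W := by
    intro m hm
    induction hm using Submonoid.closure_induction with
    | mem _ h =>
      obtain ⟨x, rfl⟩ := h
      exact ⟨k, hk, hkW x⟩
    | one => exact ⟨1, one_pos, fun a ha => by simpa using ha⟩
    | mul m m' _ _ h h' =>
      obtain ⟨n, hn, h⟩ := h
      obtain ⟨n', hn', h'⟩ := h'
      refine ⟨n * n', mul_pos hn hn', fun a ha => ?_⟩
      rw [mul_smul, end_mul_apply, ← map_nsmul]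
      exact h _ (h' a ha)
  induction τ with
  | nil =>
    refine ⟨1, one_pos, fun a ha γ hγ => ?_⟩
    rw [AddSubgroup.mem_bot.1 hγ]
    simp
  | cons m τ ih =>
    obtain ⟨n, hn, h⟩ := hmon m (hτ m (by simp))
    obtain ⟨n', hn', h'⟩ := ih fun m' hm' => hτ m' (by simp [hm'])
    refine ⟨n' * (n * k), by positivity, fun a ha γ hγ => ?_⟩
    obtain ⟨x, δ, hδ, rfl⟩ := mem_actSpan_cons.1 hγ
    rw [end_add_apply, smul_add]
    refine add_mem ?_ ?_
    · rw [mul_smul, mul_smul, end_mul_apply, ← map_nsmul]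
      exact nsmul_mem (h _ (hkW x a ha)) _
    · rw [mul_comm, mul_smul]
      exact nsmul_mem (h' a ha δ hδ) _

variable {L : FirstOrder.Language.{u, v}} {M : Type w} [L.Structure M]
  [Coding L M A] [Coding L M V] [DefAddGroup L M V]

omit [DefAddGroup L M V] in
theorem isDefMap_of_mem_closure (hρ : IsDefMap L M (fun p : A × V => ρ p.1 p.2))
    {m : AddMonoid.End V} (hm : m ∈ Submonoid.closure (Set.range ρ)) : IsDefMap L M m := by
  induction hm using Submonoid.closure_induction with
  | mem _ h =>
    obtain ⟨x, rfl⟩ := h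
    exact hρ.comp (f := fun a => (x, a)) (by fun_prop)
  | one => exact IsDefMap.id
  | mul m m' _ _ h h' => exact h.comp h'

/-- The relation that some `γ ∈ actSpan ρ τ` maps a given pair to a given pair is definable: only
the coefficients `x₁, …, xᵣ` are quantified. -/
theorem isDef_actSpan (hρ : IsDefMap L M (fun p : A × V => ρ p.1 p.2))
    {τ : List (AddMonoid.End V)} (hτ : ∀ m ∈ τ, m ∈ Submonoid.closure (Set.range ρ)) :
    IsDef L M (fun q : (V × V) × (V × V) =>
      ∃ γ ∈ actSpan ρ τ, γ q.1.1 = q.2.1 ∧ γ q.1.2 = q.2.2) := by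
  induction τ with
  | nil =>
    have h : IsDef L M (fun q : (V × V) × (V × V) => 0 = q.2.1 ∧ 0 = q.2.2) :=
      (IsDef.eq (by fun_prop) (by fun_prop)).and (IsDef.eq (by fun_prop) (by fun_prop))
    refine (congrArg (IsDef L M) (funext fun q => propext ?_)).mp h
    constructor
    · exact fun h => ⟨0, zero_mem _, h⟩
    · rintro ⟨γ, hγ, h⟩
      rwa [AddSubgroup.mem_bot.1 hγ] at h
  | cons m τ ih =>
    have ih' := ih fun m' hm' => hτ m' (by simp [hm'])
    have hm : IsDefMap L M (fun p : A × V => m (ρ p.1 p.2)) :=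
      (isDefMap_of_mem_closure hρ (hτ m (by simp))).comp hρ
    have h : IsDef L M (fun q : (V × V) × (V × V) => ∃ x : A, ∃ d : V × V,
        (∃ γ ∈ actSpan ρ τ, γ q.1.1 = d.1 ∧ γ q.1.2 = d.2) ∧
          m (ρ x q.1.1) + d.1 = q.2.1 ∧ m (ρ x q.1.2) + d.2 = q.2.2) := by
      refine IsDef.exists (IsDef.exists (IsDef.and ?_ (IsDef.and ?_ ?_)))
      · exact ih'.comp (f := fun r : (((V × V) × (V × V)) × A) × (V × V) => (r.1.1.1, r.2))
          (by fun_prop)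
      · refine IsDef.eq (IsDefMap.add (hm.comp
          (f := fun r : (((V × V) × (V × V)) × A) × (V × V) => (r.1.2, r.1.1.1.1))
          (by fun_prop)) (by fun_prop)) (by fun_prop)
      · refine IsDef.eq (IsDefMap.add (hm.comp
          (f := fun r : (((V × V) × (V × V)) × A) × (V × V) => (r.1.2, r.1.1.1.2))
          (by fun_prop)) (by fun_prop)) (by fun_prop)
    refine (congrArg (IsDef L M) (funext fun q => propext ?_)).mp h
    constructor
    · rintro ⟨x, d, ⟨γ, hγ, h₁, h₂⟩, h₃, h₄⟩
      refine ⟨_, mem_actSpan_cons.2 ⟨x, γ, hγ, rfl⟩, ?_, ?_⟩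
      · rw [← h₃, ← h₁]; rfl
      · rw [← h₄, ← h₂]; rfl
    · rintro ⟨γ, hγ, h₁, h₂⟩
      obtain ⟨x, δ, hδ, rfl⟩ := mem_actSpan_cons.1 hγ
      exact ⟨x, (δ q.1.1, δ q.1.2), ⟨δ, hδ, rfl, rfl⟩, h₁, h₂⟩

theorem isDef_mem_orbit (hρ : IsDefMap L M (fun p : A × V => ρ p.1 p.2))
    {τ : List (AddMonoid.End V)} (hτ : ∀ m ∈ τ, m ∈ Submonoid.closure (Set.range ρ)) :
    IsDef L M (fun q : V × V => q.2 ∈ orbit ρ τ q.1) := by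
  have h := (isDef_actSpan hρ hτ).comp (f := fun q : V × V => ((q.1, q.1), (q.2, q.2)))
    (by fun_prop)
  simpa only [and_self, mem_orbit] using h

/-! ### A divisible torsion-free irreducible submodule -/

variable [Nonempty M] [FinDimModel L M]

/-- The orbit of `a` under sufficiently many monomials is almost invariant: adding further monomials
eventually does not enlarge it, up to integer multiples. -/
theorem exists_almostInvariant_orbit (hρ : IsDefMap L M (fun p : A × V => ρ p.1 p.2)) (a : V) :
    ∃ τ : List (AddMonoid.End V), (∀ m ∈ τ, m ∈ Submonoid.closure (Set.range ρ)) ∧ 1 ∈ τ ∧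
      AlmostInvariant ρ (orbit ρ τ a) := by
  obtain ⟨_, ⟨τ, hτ, h1, rfl⟩, hmax⟩ := exists_maximal_almostLE L M
    (fun H : AddSubgroup V => ∃ τ : List (AddMonoid.End V),
      (∀ m ∈ τ, m ∈ Submonoid.closure (Set.range ρ)) ∧ 1 ∈ τ ∧ H = orbit ρ τ a)
    ⟨_, [1], by simp [one_mem], by simp, rfl⟩ (by
      rintro _ ⟨τ, hτ, -, rfl⟩
      exact (isDef_mem_orbit hρ hτ).comp (f := fun b => (a, b)) (by fun_prop))
  have hdef : IsDef L M (· ∈ orbit ρ τ a) :=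
    (isDef_mem_orbit hρ hτ).comp (f := fun b => (a, b)) (by fun_prop)
  refine ⟨τ, hτ, h1, ?_⟩
  have hx : ∀ x, AlmostLE (orbit ρ τ a) ((orbit ρ τ a).comap (ρ x)) := by
    intro x
    have hτ' : ∀ m ∈ τ.map (ρ x * ·) ++ τ, m ∈ Submonoid.closure (Set.range ρ) := by
      intro m hm
      rcases List.mem_append.1 hm with h | h
      · obtain ⟨m', hm', rfl⟩ := List.mem_map.1 h
        exact mul_mem (Submonoid.subset_closure ⟨x, rfl⟩) (hτ m' hm')
      · exact hτ m h
    obtain ⟨c, hc, h⟩ := hmax _ ⟨_, hτ', List.mem_append_right _ h1, rfl⟩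
      (orbit_le_append_right τ _ a)
    refine ⟨c, hc, ?_⟩
    rintro _ ⟨γ, hγ, rfl⟩
    change ρ x (c • γ a) ∈ orbit ρ τ a
    rw [map_nsmul]
    exact h _ ⟨ρ x * γ, actSpan_le_append_left _ _ (mul_mem_actSpan hγ _), rfl⟩
  obtain ⟨N, hN, h⟩ := exists_nsmul_mem_of_almostLE (L := L) (M := M)
    (W := fun x => (orbit ρ τ a).comap (ρ x))
    (hdef.comp (f := fun q : A × V => ρ q.1 q.2) hρ) hdef
  refine ⟨N, hN, fun x b hb => ?_⟩
  have := h x (hx x) b hb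
  change ρ x (N • b) ∈ orbit ρ τ a at this
  rwa [map_nsmul] at this

/-- If, up to integer multiples, the module `V` has no proper nontrivial definable invariant
subgroup, it has a definable submodule that is divisible, torsion-free, and without any
proper nontrivial definable almost invariant subgroup. -/
theorem exists_irreducible_submodule (hρ : IsDefMap L M (fun p : A × V => ρ p.1 p.2))
    (hmin : ∀ W : AddSubgroup V, IsDef L M (· ∈ W) → (∀ x, ∀ a ∈ W, ρ x a ∈ W) →
      AlmostLE W ⊥ ∨ AlmostLE ⊤ W)
    (hne : ∀ n : ℕ, 0 < n → ∃ x a, n • ρ x a ≠ 0) :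
    ∃ U : AddSubgroup V, IsDef L M (· ∈ U) ∧ (∀ x, ∀ a ∈ U, ρ x a ∈ U) ∧ U ≠ ⊥ ∧
      (∀ n : ℕ, 0 < n → ∀ a ∈ U, ∃ b ∈ U, n • b = a) ∧
      (∀ n : ℕ, 0 < n → ∀ a ∈ U, n • a = 0 → a = 0) ∧
      ∀ W ≤ U, IsDef L M (· ∈ W) → AlmostInvariant ρ W → W = ⊥ ∨ W = U := by
  -- `W` is an almost invariant subgroup that is minimal up to integer multiples.
  obtain ⟨W, ⟨hWdef, hWinv, hW0⟩, hWmin⟩ := exists_minimal_almostLE L M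
    (fun W : AddSubgroup V => IsDef L M (· ∈ W) ∧ AlmostInvariant ρ W ∧ ¬ AlmostLE W ⊥)
    ⟨⊤, by simpa using IsDef.true, ⟨1, one_pos, fun _ _ _ => trivial⟩, by
      rintro ⟨c, hc, h⟩
      obtain ⟨x, a, ha⟩ := hne c hc
      exact ha (h _ trivial)⟩ (fun W h => h.1)
  -- If all orbits of elements of `W` had bounded exponent, the exponents would have a common bound.
  obtain ⟨a, haW, ha⟩ : ∃ a ∈ W, ¬ AlmostLE (orbit ρ [1] a) ⊥ := by
    by_contra! h
    obtain ⟨N, hN, h'⟩ := exists_nsmul_eq_zero_of_almostLE (L := L) (M := M)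
      (isDef_mem_orbit hρ (τ := [1]) (by simp [one_mem]))
    let Z : AddSubgroup V :=
      { carrier := {a | ∀ x, N • ρ x a = 0}
        zero_mem' := fun x => by simp
        add_mem' := fun {a b} ha hb x => by rw [map_add, smul_add, ha x, hb x, add_zero]
        neg_mem' := fun {a} ha x => by rw [map_neg, smul_neg, ha x, neg_zero] }
    have hWZ : W ≤ Z := fun a ha x =>
      h' a (h a ha) _ ⟨ρ x, by
        simpa using mul_ρ_mem_actSpan (ρ := ρ) (τ := [1]) (List.mem_singleton_self 1) x, rfl⟩
    rcases hmin Z (IsDef.forall (p := fun a x => N • ρ x a = 0)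
      (IsDef.eq (IsDefMap.nsmul N (hρ.comp (f := fun q : V × A => (q.2, q.1)) (by fun_prop)))
        (by fun_prop)))
      (fun x a ha y => by rw [← map_nsmul, ha x, map_zero]) with h₁ | ⟨c, hc, h₁⟩
    · exact hW0 ((AlmostLE.of_le hWZ).trans h₁)
    · obtain ⟨x, a, hxa⟩ := hne (N * c) (mul_pos hN hc)
      refine hxa ?_
      rw [mul_smul, ← map_nsmul]
      exact h₁ a trivial x
  obtain ⟨τ, hτ, h1, hτinv⟩ := exists_almostInvariant_orbit hρ a
  obtain ⟨c, hc, hcW⟩ := hWinv.exists_nsmul_mem hτ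
  have horb := isDef_mem_orbit hρ hτ
  -- The orbit of `c • a` is almost invariant and contained in `W`, hence almost equal to it.
  have hle : orbit ρ τ (c • a) ≤ W := by
    rintro _ ⟨γ, hγ, rfl⟩
    rw [map_nsmul]
    exact hcW a haW γ hγ
  have hge : AlmostLE W (orbit ρ τ (c • a)) := by
    refine hWmin _ ⟨horb.comp (f := fun b => (c • a, b)) (by fun_prop), ?_, ?_⟩ hle
    · obtain ⟨n, hn, h⟩ := hτinv
      refine ⟨n, hn, fun x b hb => ?_⟩
      obtain ⟨d, hd, rfl⟩ := exists_of_mem_orbit_nsmul hb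
      rw [map_nsmul, smul_comm]
      exact nsmul_mem_orbit c (h x d hd)
    · rintro ⟨n, hn, h⟩
      refine ha ⟨n * c, mul_pos hn hc, ?_⟩
      rintro _ ⟨γ, hγ, rfl⟩
      obtain ⟨x, δ, hδ, rfl⟩ := mem_actSpan_cons.1 hγ
      rw [mul_smul]
      refine h _ (nsmul_mem_orbit c ⟨_, mul_ρ_mem_actSpan h1 x, ?_⟩)
      rw [AddSubgroup.mem_bot.1 hδ, add_zero]
  -- The orbits of the `k • c • a` are the multiples of a subgroup almost equal to `W`, and they
  -- belong to a definable family: a fixed multiple of `W` is therefore contained in all of them.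
  obtain ⟨N, hN, hNW⟩ := exists_nsmul_mem_of_almostLE horb hWdef
  have hdiv : ∀ k : ℕ, 0 < k → ∀ b ∈ W, ∃ d ∈ orbit ρ τ (c • a), k • d = N • b := by
    intro k hk b hb
    refine exists_of_mem_orbit_nsmul (hNW (k • c • a) ?_ b hb)
    obtain ⟨n, hn, h⟩ := hge
    exact ⟨k * n, mul_pos hk hn, fun d hd => by rw [mul_smul]; exact nsmul_mem_orbit k (h d hd)⟩
  -- The `γ (c • a)` with `γ b = 0` form a definable family of subgroups indexed by `b`; the one for
  -- `b = n • c • a` is annihilated by `n`, hence by a fixed `N'`.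
  let K : V → AddSubgroup V := fun b =>
    { carrier := {d | ∃ γ ∈ actSpan ρ τ, γ (c • a) = d ∧ γ b = 0}
      zero_mem' := ⟨0, zero_mem _, rfl, rfl⟩
      add_mem' := by
        rintro _ _ ⟨γ, hγ, rfl, h⟩ ⟨δ, hδ, rfl, h'⟩
        exact ⟨γ + δ, add_mem hγ hδ, rfl, by rw [end_add_apply, h, h', add_zero]⟩
      neg_mem' := by
        rintro _ ⟨γ, hγ, rfl, h⟩
        exact ⟨-γ, neg_mem hγ, rfl, neg_eq_zero.2 h⟩ }
  obtain ⟨N', hN', hK⟩ := exists_nsmul_eq_zero_of_almostLE (L := L) (M := M) (W := K)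
    ((isDef_actSpan hρ hτ).comp (f := fun q : V × V => ((c • a, q.1), (q.2, 0))) (by fun_prop))
  -- Almost equal subgroups of the divisible torsion-free group `N W` are equal.
  let U : AddSubgroup V := W.map (nsmulAddMonoidHom N)
  have hUW : U ≤ W := by
    rintro _ ⟨b, hb, rfl⟩
    exact nsmul_mem hb N
  have hUdiv : ∀ n : ℕ, 0 < n → ∀ b ∈ U, ∃ d ∈ U, n • d = b := by
    rintro n hn _ ⟨b, hb, rfl⟩
    obtain ⟨d, hd, h⟩ := hdiv (n * N) (mul_pos hn hN) b hb
    exact ⟨N • d, ⟨d, hle hd, rfl⟩, by rw [← mul_smul]; exact h⟩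
  have htors : ∀ n : ℕ, 0 < n → ∀ b ∈ U, n • b = 0 → N' • b = 0 := by
    rintro n hn _ ⟨b, hb, rfl⟩ h0
    obtain ⟨d, ⟨γ, hγ, rfl⟩, h⟩ := hdiv 1 one_pos b hb
    rw [one_smul] at h
    refine hK (n • c • a) ⟨n, hn, ?_⟩ _ ⟨γ, hγ, h, ?_⟩
    · rintro _ ⟨δ, hδ, rfl, h'⟩
      rwa [← map_nsmul]
    · rw [map_nsmul, h]
      exact h0
  have hUtf : ∀ n : ℕ, 0 < n → ∀ b ∈ U, n • b = 0 → b = 0 := by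
    intro n hn b hb h0
    obtain ⟨d, hd, rfl⟩ := hUdiv N' hN' b hb
    exact htors (n * N') (mul_pos hn hN') d hd (by rwa [mul_smul])
  refine ⟨U, ?_, ?_, ?_, hUdiv, hUtf, ?_⟩
  · exact hWdef.image (f := fun b => N • b) (by fun_prop)
  · intro x b hb
    obtain ⟨m, hm, h⟩ := hWinv
    obtain ⟨_, ⟨d, hd, rfl⟩, rfl⟩ := hUdiv m hm b hb
    refine ⟨m • ρ x d, h x d hd, ?_⟩
    simp only [nsmulAddMonoidHom_apply, map_nsmul]
  · intro h
    refine hW0 ⟨N, hN, fun b hb => ?_⟩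
    rw [← h]
    exact ⟨b, hb, rfl⟩
  · intro H hHU hHdef hHinv
    by_cases hH : AlmostLE H ⊥
    · left
      obtain ⟨n, hn, h⟩ := hH
      exact (AddSubgroup.eq_bot_iff_forall _).2 fun b hb => hUtf n hn b (hHU hb) (h b hb)
    · right
      obtain ⟨n, hn, h⟩ := hWmin H ⟨hHdef, hHinv, hH⟩ (hHU.trans hUW)
      refine le_antisymm hHU fun b hb => ?_
      obtain ⟨d, hd, rfl⟩ := hUdiv n hn b hb
      exact h d (hUW hd)

end Action

end FinDimLie

namespace FinDimLie

/-! ### The field of a divisible torsion-free irreducible module -/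

section DefField

variable (L : FirstOrder.Language.{u, v}) (M : Type w) [L.Structure M]

/-- The operations of the coded field `K` are definable. -/
class DefField (K : Type*) [Field K] [Coding L M K] : Prop extends DefAddGroup L M K where
  mul : IsDefMap L M (fun p : K × K => p.1 * p.2)

variable {L M} in
@[fun_prop] theorem IsDefMap.mul {X K : Type*} [Coding L M X] [Field K] [Coding L M K]
    [DefField L M K] {f g : X → K} (hf : IsDefMap L M f) (hg : IsDefMap L M g) :
    IsDefMap L M (fun x => f x * g x) :=
  DefField.mul.comp (hf.prodMk hg)

theorem Coding.small (X : Type*) [C : Coding L M X] : Small.{w} X := by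
  have : Function.Surjective (fun c : {c : C.ι → M // ∃ x, C.Code c x} => c.2.choose) := by
    intro x
    obtain ⟨c, hc⟩ := C.exists_code x
    have h : ∃ x, C.Code c x := ⟨x, hc⟩
    exact ⟨⟨c, h⟩, C.unique h.choose_spec hc⟩
  exact small_of_surjective this

/-- A definable field with a definable action may be replaced by a copy in the universe of `M`. -/
theorem exists_field_in_universe {K₀ V : Type*} [Field K₀] [Coding L M K₀] [DefField L M K₀]
    [AddCommGroup V] [Coding L M V] [Module K₀ V]
    (hsmul : IsDefMap L M (fun p : K₀ × V => p.1 • p.2)) :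
    ∃ (K : Type w) (_ : Field K) (_ : Coding L M K) (_ : Module K V) (e : K ≃+* K₀),
      DefField L M K ∧ IsDefMap L M (fun p : K × V => p.1 • p.2) ∧
      ∀ (k : K) (a : V), k • a = e k • a := by
  have := Coding.small L M K₀
  obtain ⟨K, ⟨e'⟩⟩ := Small.equiv_small.{w} (α := K₀)
  let _ : Field K := e'.symm.field
  let e : K ≃+* K₀ := e'.symm.ringEquiv
  have hrange : IsDef L M (· ∈ Set.range e) := by
    simpa [e.surjective.range_eq] using IsDef.true
  let _ : Coding L M K := Coding.ofInjective L M e e.injective hrange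
  let _ : Module K V := Module.compHom V (e : K →+* K₀)
  have he : IsDefMap L M e := Coding.isDefMap_ofInjective e e.injective hrange
  have hadd : DefAddGroup L M K := ⟨IsDefMap.of_comp_injective he e.injective (by
    simp only [map_add]
    fun_prop)⟩
  refine ⟨K, inferInstance, inferInstance, inferInstance, e, ⟨?_⟩, ?_, fun k a => rfl⟩
  · refine IsDefMap.of_comp_injective he e.injective ?_
    simp only [map_mul]
    fun_prop
  · exact hsmul.comp (f := fun p : K × V => (e p.1, p.2)) (by fun_prop)

end DefField

section Irreducible

variable {A V : Type*} [AddCommGroup A] [AddCommGroup V] {ρ : A →+ AddMonoid.End V}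

/-- Endomorphisms of the module commute with sums of monomials. -/
theorem commute_of_mem_centralizer {f : AddMonoid.End V}
    (hf : f ∈ Subring.centralizer (Set.range ρ)) {τ : List (AddMonoid.End V)}
    (hτ : ∀ m ∈ τ, m ∈ Submonoid.closure (Set.range ρ)) {γ : AddMonoid.End V}
    (hγ : γ ∈ actSpan ρ τ) (a : V) : f (γ a) = γ (f a) := by
  have hx : ∀ x a, f (ρ x a) = ρ x (f a) := fun x a =>
    (DFunLike.congr_fun (Subring.mem_centralizer_iff.1 hf (ρ x) ⟨x, rfl⟩) a).symm
  have hm : ∀ m ∈ Submonoid.closure (Set.range ρ), ∀ a, f (m a) = m (f a) := by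
    intro m hm
    induction hm using Submonoid.closure_induction with
    | mem _ h =>
      obtain ⟨x, rfl⟩ := h
      exact hx x
    | one => exact fun a => rfl
    | mul m m' _ _ h h' =>
      intro a
      rw [end_mul_apply, h, h', end_mul_apply]
  induction τ generalizing γ with
  | nil =>
    rw [AddSubgroup.mem_bot.1 hγ]
    exact map_zero f
  | cons m τ ih =>
    obtain ⟨x, δ, hδ, rfl⟩ := mem_actSpan_cons.1 hγ
    rw [end_add_apply, end_add_apply, end_mul_apply, end_mul_apply, map_add,
      hm m (hτ m (by simp)), hx, ih (fun m' hm' => hτ m' (by simp [hm'])) hδ]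

/-- The elements of the module that are annihilated by all `γ ∈ actSpan ρ τ` with `γ a = 0`.
If `τ` consists of monomials in the action, they include the images of `a` under the endomorphisms
of the module. -/
def annClosure (ρ : A →+ AddMonoid.End V) (τ : List (AddMonoid.End V)) (a : V) :
    AddSubgroup V where
  carrier := {b | ∀ γ ∈ actSpan ρ τ, γ a = 0 → γ b = 0}
  zero_mem' := fun γ _ _ => map_zero γ
  add_mem' := fun hb hc γ hγ h => by rw [map_add, hb γ hγ h, hc γ hγ h, add_zero]
  neg_mem' := fun hb γ hγ h => by rw [map_neg, hb γ hγ h, neg_zero]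

variable {L : FirstOrder.Language.{u, v}} {M : Type w} [L.Structure M] [Nonempty M]
  [FinDimModel L M] [Coding L M A] [Coding L M V] [DefAddGroup L M V]

omit [Nonempty M] [FinDimModel L M] in
theorem isDef_mem_annClosure (hρ : IsDefMap L M (fun p : A × V => ρ p.1 p.2))
    {τ : List (AddMonoid.End V)} (hτ : ∀ m ∈ τ, m ∈ Submonoid.closure (Set.range ρ)) (a : V) :
    IsDef L M (· ∈ annClosure ρ τ a) := by
  have h : IsDef L M (fun b : V => ∀ c, (∃ γ ∈ actSpan ρ τ, γ a = 0 ∧ γ b = c) → c = 0) :=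
    IsDef.forall (IsDef.imp ((isDef_actSpan hρ hτ).comp
      (f := fun q : V × V => ((a, q.1), (0, q.2))) (by fun_prop))
      (IsDef.eq (by fun_prop) (by fun_prop)))
  refine (congrArg (IsDef L M) (funext fun b => propext ?_)).mp h
  constructor
  · exact fun h γ hγ h₀ => h _ ⟨γ, hγ, h₀, rfl⟩
  · rintro h _ ⟨γ, hγ, h₀, rfl⟩
    exact h γ hγ h₀

/-- For a suitable `τ`, every element of `V` is of the form `γ a` with `γ ∈ actSpan ρ τ`, and
the elements of `annClosure ρ τ a` are the images of `a` under the endomorphisms of the module. -/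
theorem exists_annClosure_eq (hρ : IsDefMap L M (fun p : A × V => ρ p.1 p.2))
    (htf : ∀ n : ℕ, 0 < n → ∀ a : V, n • a = 0 → a = 0)
    (hirr : ∀ W : AddSubgroup V, IsDef L M (· ∈ W) → AlmostInvariant ρ W → W = ⊥ ∨ W = ⊤)
    (hker : ∀ a : V, (∀ x, ρ x a = 0) → a = 0) {a : V} (ha : a ≠ 0) :
    ∃ τ : List (AddMonoid.End V), (∀ m ∈ τ, m ∈ Submonoid.closure (Set.range ρ)) ∧
      (∀ b, b ∈ orbit ρ τ a) ∧
      ∀ b ∈ annClosure ρ τ a, ∃ f ∈ Subring.centralizer (Set.range ρ), f a = b := by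
  obtain ⟨τ₀, hτ₀, h1, hinv⟩ := exists_almostInvariant_orbit hρ a
  have htop : ∀ b, b ∈ orbit ρ τ₀ a := by
    rcases hirr _ ((isDef_mem_orbit hρ hτ₀).comp (f := fun b => (a, b)) (by fun_prop)) hinv with
      h | h
    · refine absurd (hker a fun x => ?_) ha
      rw [← AddSubgroup.mem_bot, ← h]
      exact ⟨ρ x, by simpa using mul_ρ_mem_actSpan h1 x, rfl⟩
    · exact fun b => h ▸ AddSubgroup.mem_top b
  obtain ⟨_, ⟨τ, hτ, h1, htop, rfl⟩, hmin⟩ := exists_minimal_almostLE L M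
    (fun H : AddSubgroup V => ∃ τ : List (AddMonoid.End V),
      (∀ m ∈ τ, m ∈ Submonoid.closure (Set.range ρ)) ∧ 1 ∈ τ ∧ (∀ b, b ∈ orbit ρ τ a) ∧
      H = annClosure ρ τ a) ⟨_, τ₀, hτ₀, h1, htop, rfl⟩ (by
      rintro _ ⟨τ, hτ, -, -, rfl⟩
      exact isDef_mem_annClosure hρ hτ a)
  -- As `V` is torsion-free, longer lists of monomials do not give smaller groups.
  have hann : ∀ b ∈ annClosure ρ τ a, ∀ τ' : List (AddMonoid.End V),
      (∀ m ∈ τ', m ∈ Submonoid.closure (Set.range ρ)) → ∀ γ ∈ actSpan ρ (τ' ++ τ),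
      γ a = 0 → γ b = 0 := by
    intro b hb τ' hτ' γ hγ h0
    obtain ⟨n, hn, h⟩ := hmin (annClosure ρ (τ' ++ τ) a) ⟨_, fun m hm =>
      (List.mem_append.1 hm).elim (hτ' m) (hτ m), List.mem_append_right _ h1,
      fun b => orbit_le_append_right τ τ' a (htop b), rfl⟩
      (fun c hc γ hγ => hc γ (actSpan_le_append_right τ τ' hγ))
    refine htf n hn _ ?_
    rw [← map_nsmul]
    exact h b hb γ hγ h0
  refine ⟨τ, hτ, htop, fun b hb => ?_⟩
  -- `b` determines the endomorphism that maps `γ a` to `γ b`.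
  choose g hg hga using htop
  have hb' : ∀ γ ∈ actSpan ρ τ, γ a = 0 → γ b = 0 := hb
  let f : AddMonoid.End V :=
    { toFun := fun c => g c b
      map_zero' := hb' _ (hg 0) (hga 0)
      map_add' := fun c d => by
        have h := hb' (g (c + d) - (g c + g d))
          (sub_mem (hg _) (add_mem (hg c) (hg d))) (by
            change g (c + d) a - (g c a + g d a) = 0
            rw [hga, hga, hga, sub_self])
        exact sub_eq_zero.1 h }
  have hfx : ∀ x c, f (ρ x c) = ρ x (f c) := by
    intro x c
    have h := hann b hb (τ.map (ρ x * ·)) (fun m hm => by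
        obtain ⟨m', hm', rfl⟩ := List.mem_map.1 hm
        exact mul_mem (Submonoid.subset_closure ⟨x, rfl⟩) (hτ m' hm'))
      (g (ρ x c) - ρ x * g c)
      (sub_mem (actSpan_le_append_right _ _ (hg _))
        (actSpan_le_append_left _ _ (mul_mem_actSpan (hg c) _))) (by
        change g (ρ x c) a - ρ x (g c a) = 0
        rw [hga, hga, sub_self])
    exact sub_eq_zero.1 h
  refine ⟨f, Subring.mem_centralizer_iff.2 ?_, ?_⟩
  · rintro _ ⟨x, rfl⟩
    exact AddMonoidHom.ext fun c => (hfx x c).symm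
  · refine sub_eq_zero.1 (hker _ fun x => ?_)
    rw [map_sub, ← hfx, sub_eq_zero]
    refine sub_eq_zero.1 (hb' (g (ρ x a) - ρ x) (sub_mem (hg _) ?_) ?_)
    · simpa using mul_ρ_mem_actSpan h1 x
    · change g (ρ x a) a - ρ x a = 0
      rw [hga, sub_self]

/-- On a torsion-free irreducible module there is a definable field structure with respect to which
the action is linear: the centre of the endomorphism ring of the module. -/
theorem exists_field (hρ : IsDefMap L M (fun p : A × V => ρ p.1 p.2))
    (htf : ∀ n : ℕ, 0 < n → ∀ a : V, n • a = 0 → a = 0)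
    (hirr : ∀ W : AddSubgroup V, IsDef L M (· ∈ W) → AlmostInvariant ρ W → W = ⊥ ∨ W = ⊤)
    (hact : ∃ x a, ρ x a ≠ 0) :
    ∃ (K : Type w) (_ : Field K) (_ : Coding L M K) (_ : Module K V), DefField L M K ∧
      IsDefMap L M (fun p : K × V => p.1 • p.2) ∧
      ∀ (k : K) (x : A) (a : V), ρ x (k • a) = k • ρ x a := by
  have hirr' : ∀ W : AddSubgroup V, IsDef L M (· ∈ W) → (∀ x, ∀ b ∈ W, ρ x b ∈ W) →
      W = ⊥ ∨ W = ⊤ := fun W h h' => hirr W h ⟨1, one_pos, by simpa using h'⟩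
  have hker : ∀ a : V, (∀ x, ρ x a = 0) → a = 0 := by
    let Z : AddSubgroup V :=
      { carrier := {a | ∀ x, ρ x a = 0}
        zero_mem' := fun x => by simp
        add_mem' := fun {a b} ha hb x => by rw [map_add, ha x, hb x, add_zero]
        neg_mem' := fun {a} ha x => by rw [map_neg, ha x, neg_zero] }
    have hZ : Z = ⊥ ∨ Z = ⊤ := hirr' Z (IsDef.forall (p := fun a x => ρ x a = 0)
      (IsDef.eq (hρ.comp (f := fun q : V × A => (q.2, q.1)) (by fun_prop)) (by fun_prop)))
      (fun x a ha y => by rw [ha x, map_zero])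
    rcases hZ with h | h
    · intro a ha
      rw [← AddSubgroup.mem_bot, ← h]
      exact ha
    · obtain ⟨x, a, hxa⟩ := hact
      have : a ∈ Z := h ▸ AddSubgroup.mem_top a
      exact absurd (this x) hxa
  obtain ⟨x₀, a₀, h₀⟩ := hact
  have ha : a₀ ≠ 0 := by
    rintro rfl
    exact h₀ (map_zero _)
  obtain ⟨τ, hτ, htop, hcl⟩ := exists_annClosure_eq hρ htf hirr hker ha
  let D : Subring (AddMonoid.End V) := Subring.centralizer (Set.range ρ)
  have hD : ∀ f ∈ D, ∀ γ ∈ actSpan ρ τ, ∀ c, f (γ c) = γ (f c) := fun f hf γ hγ c =>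
    commute_of_mem_centralizer hf hτ hγ c
  have hDx : ∀ f ∈ D, ∀ x c, ρ x (f c) = f (ρ x c) := fun f hf x c =>
    DFunLike.congr_fun (Subring.mem_centralizer_iff.1 hf (ρ x) ⟨x, rfl⟩) c
  have hcl' : ∀ b, b ∈ annClosure ρ τ a₀ ↔ ∃ f ∈ D, f a₀ = b := by
    refine fun b => ⟨hcl b, ?_⟩
    rintro ⟨f, hf, rfl⟩ γ hγ h
    rw [← hD f hf γ hγ, h, map_zero]
  -- An endomorphism is determined by its value at `a₀`, and is definable from it.
  have hgraph : ∀ f ∈ D, ∀ c d, f c = d ↔ ∃ γ ∈ actSpan ρ τ, γ a₀ = c ∧ γ (f a₀) = d := by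
    intro f hf c d
    constructor
    · rintro rfl
      obtain ⟨γ, hγ, rfl⟩ := htop c
      exact ⟨γ, hγ, rfl, (hD f hf γ hγ _).symm⟩
    · rintro ⟨γ, hγ, rfl, rfl⟩
      exact hD f hf γ hγ _
  have hext : ∀ f ∈ D, ∀ g ∈ D, f a₀ = g a₀ → f = g := by
    intro f hf g hg h
    refine AddMonoidHom.ext fun c => (hgraph f hf c (g c)).2 ?_
    rw [h]
    exact (hgraph g hg c _).1 rfl
  have hdef : ∀ f ∈ D, IsDefMap L M f := by
    intro f hf
    have := (isDef_actSpan hρ hτ).comp (f := fun q : V × V => ((a₀, f a₀), q)) (by fun_prop)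
    refine (congrArg (IsDef L M) (funext fun q => propext ?_)).mp this
    exact (hgraph f hf q.1 q.2).symm
  -- Schur's lemma.
  have hbij : ∀ f ∈ D, f ≠ 0 → Function.Bijective f := by
    intro f hf hf0
    constructor
    · refine (injective_iff_map_eq_zero f).2 fun c hc => ?_
      rcases hirr' (AddMonoidHom.ker f) (IsDef.eq (hdef f hf) (by fun_prop)) (fun x b hb => by
        change f (ρ x b) = 0
        rw [← hDx f hf, show f b = 0 from hb, map_zero]) with h | h
      · rw [← AddSubgroup.mem_bot, ← h]
        exact hc
      · refine absurd (AddMonoidHom.ext fun b => ?_) hf0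
        have : b ∈ AddMonoidHom.ker f := h ▸ AddSubgroup.mem_top b
        exact this
    · have hr : IsDef L M (· ∈ AddMonoidHom.range f) := by
        have h := (IsDef.true (X := V)).image (hdef f hf)
        simp only [true_and] at h
        exact h
      rcases hirr' (AddMonoidHom.range f) hr (by
        rintro x _ ⟨b, rfl⟩
        exact ⟨ρ x b, (hDx f hf x b).symm⟩) with h | h
      · refine absurd (AddMonoidHom.ext fun b => ?_) hf0
        have : f b ∈ AddMonoidHom.range f := ⟨b, rfl⟩
        rw [h] at this
        exact this
      · intro b
        have : b ∈ AddMonoidHom.range f := h ▸ AddSubgroup.mem_top b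
        exact this
  let K₀ : Subring (AddMonoid.End V) := D ⊓ Subring.centralizer (D : Set (AddMonoid.End V))
  have hcomm : ∀ f ∈ K₀, ∀ g ∈ D, ∀ c, g (f c) = f (g c) := fun f hf g hg c =>
    DFunLike.congr_fun (Subring.mem_centralizer_iff.1 hf.2 g hg) c
  have hfield : IsField K₀ := by
    refine ⟨⟨0, 1, fun h => ha ?_⟩, ?_, ?_⟩
    · exact (DFunLike.congr_fun (congrArg Subtype.val h) a₀).symm
    · exact fun f g => Subtype.ext (Subring.mem_centralizer_iff.1 g.2.2 f.1 f.2.1)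
    · rintro ⟨f, hf⟩ hf0
      have hb := hbij f hf.1 fun h => hf0 (Subtype.ext h)
      let e : V ≃+ V := AddEquiv.ofBijective (f : V →+ V) hb
      have he : ∀ c, e c = f c := fun c => rfl
      let g : AddMonoid.End V := (e.symm : V →+ V)
      have hfg : ∀ c, f (g c) = c := fun c => e.apply_symm_apply c
      have hcom : ∀ h : AddMonoid.End V, (∀ c, h (f c) = f (h c)) → h * g = g * h := by
        intro h hh
        refine AddMonoidHom.ext fun c => hb.1 ?_
        change f (h (g c)) = f (g (h c))
        rw [← hh, hfg, hfg]
      refine ⟨⟨g, Subring.mem_centralizer_iff.2 ?_, Subring.mem_centralizer_iff.2 ?_⟩, ?_⟩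
      · rintro _ ⟨x, rfl⟩
        exact hcom _ (hDx f hf.1 x)
      · exact fun h hh => hcom h (hcomm f hf h hh)
      · exact Subtype.ext (AddMonoidHom.ext hfg)
  let _ : Field K₀ := hfield.toField
  -- The field is coded by the values at `a₀`: a value `b` belongs to the centre if and only if, for
  -- every value `c`, the endomorphisms with these values commute at `a₀`.
  let ev : K₀ → V := fun f => f.1 a₀
  have hev : Function.Injective ev := fun f g h => Subtype.ext (hext _ f.2.1 _ g.2.1 h)
  have hrange : IsDef L M (· ∈ Set.range ev) := by
    have h : IsDef L M (fun b => b ∈ annClosure ρ τ a₀ ∧ ∀ c, c ∈ annClosure ρ τ a₀ → ∃ d,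
        (∃ γ ∈ actSpan ρ τ, γ a₀ = b ∧ γ c = d) ∧ ∃ γ ∈ actSpan ρ τ, γ a₀ = c ∧ γ b = d) := by
      refine IsDef.and (isDef_mem_annClosure hρ hτ a₀) (IsDef.forall (IsDef.imp
        ((isDef_mem_annClosure hρ hτ a₀).comp IsDefMap.snd) (IsDef.exists (IsDef.and ?_ ?_))))
      · exact (isDef_actSpan hρ hτ).comp
          (f := fun q : (V × V) × V => ((a₀, q.1.2), (q.1.1, q.2))) (by fun_prop)
      · exact (isDef_actSpan hρ hτ).comp
          (f := fun q : (V × V) × V => ((a₀, q.1.1), (q.1.2, q.2))) (by fun_prop)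
    refine (congrArg (IsDef L M) (funext fun b => propext ?_)).mp h
    constructor
    · rintro ⟨hb, h⟩
      obtain ⟨f, hf, rfl⟩ := (hcl' b).1 hb
      refine ⟨⟨f, hf, Subring.mem_centralizer_iff.2 fun g hg => ?_⟩, rfl⟩
      obtain ⟨d, h₁, h₂⟩ := h (g a₀) ((hcl' _).2 ⟨g, hg, rfl⟩)
      refine hext _ (mul_mem hg hf) _ (mul_mem hf hg) ?_
      rw [end_mul_apply, end_mul_apply, (hgraph g hg _ _).2 h₁, (hgraph f hf _ _).2 h₂]
    · rintro ⟨f, rfl⟩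
      refine ⟨(hcl' _).2 ⟨f, f.2.1, rfl⟩, fun c hc => ?_⟩
      obtain ⟨g, hg, rfl⟩ := (hcl' c).1 hc
      refine ⟨g (f.1 a₀), (hgraph g hg _ _).1 rfl, (hgraph f.1 f.2.1 _ _).1 ?_⟩
      exact (hcomm f.1 f.2 g hg _).symm
  let _ : Coding L M K₀ := Coding.ofInjective L M ev hev hrange
  have hevdef : IsDefMap L M ev := Coding.isDefMap_ofInjective ev hev hrange
  have happ : IsDefMap L M (fun p : K₀ × V => p.1.1 p.2) := by
    have := (isDef_actSpan hρ hτ).comp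
      (f := fun q : (K₀ × V) × V => ((a₀, ev q.1.1), (q.1.2, q.2))) (by fun_prop)
    refine (congrArg (IsDef L M) (funext fun q => propext ?_)).mp this
    exact (hgraph _ q.1.1.2.1 q.1.2 q.2).symm
  have hadd : DefAddGroup L M K₀ := ⟨IsDefMap.of_comp_injective hevdef hev
    (IsDefMap.add (f := fun p : K₀ × K₀ => ev p.1) (g := fun p : K₀ × K₀ => ev p.2)
      (by fun_prop) (by fun_prop))⟩
  have hmul : DefField L M K₀ := ⟨IsDefMap.of_comp_injective hevdef hev
    (happ.comp (f := fun p : K₀ × K₀ => (p.1, ev p.2)) (by fun_prop))⟩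
  let _ : Module K₀ V := Module.compHom V (R := AddMonoid.End V) K₀.subtype
  obtain ⟨K, _, _, _, e, h₁, h₂, h₃⟩ := exists_field_in_universe L M (K₀ := K₀) (V := V) happ
  refine ⟨K, _, _, _, h₁, h₂, fun k x c => ?_⟩
  rw [h₃, h₃]
  exact hDx _ (e k).2.1 x c

end Irreducible

/-! ### Definable modules over definable fields of characteristic zero -/

section DefModule

variable {L : FirstOrder.Language.{u, v}} {M : Type w} [L.Structure M] [Nonempty M]
  [FinDimModel L M] {K V : Type*} [Field K] [Coding L M K] [AddCommGroup V] [Coding L M V]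
  [DefAddGroup L M V] [Module K V]

omit [Nonempty M] [FinDimModel L M] in
theorem isDef_mem_of_fg (hsmul : IsDefMap L M (fun p : K × V => p.1 • p.2)) (N : Submodule K V)
    (hN : N.FG) : IsDef L M (· ∈ N) := by
  induction N, hN using Submodule.fg_induction with
  | singleton a =>
    simp only [Submodule.mem_span_singleton]
    exact IsDef.exists (p := fun b k => k • a = b) (IsDef.eq
      (hsmul.comp (f := fun q : V × K => (q.2, a)) (by fun_prop)) (by fun_prop))
  | sup N₁ N₂ h₁ h₂ ih₁ ih₂ =>
    have := IsDef.mem_sup (X := V) (H := fun _ => N₁.toAddSubgroup) (K := fun _ => N₂.toAddSubgroup)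
      (ih₁.comp IsDefMap.snd) (ih₂.comp IsDefMap.snd)
    rw [← Submodule.sup_toAddSubgroup] at this
    exact this.comp (f := fun a => (a, a)) (by fun_prop)

/-- A definable vector space over a definable field of characteristic zero has finite dimension,
by the ascending chain condition for finitely generated subspaces. -/
theorem moduleFinite_of_definable [CharZero K]
    (hsmul : IsDefMap L M (fun p : K × V => p.1 • p.2)) : Module.Finite K V := by
  obtain ⟨_, ⟨N, hN, rfl⟩, hmax⟩ := exists_maximal_almostLE L M
    (fun H : AddSubgroup V => ∃ N : Submodule K V, N.FG ∧ H = N.toAddSubgroup)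
    ⟨_, ⊥, Submodule.fg_bot, rfl⟩ (by
      rintro _ ⟨N, hN, rfl⟩
      exact isDef_mem_of_fg hsmul N hN)
  refine ⟨?_⟩
  convert hN
  refine (eq_top_iff.2 fun a _ => ?_).symm
  obtain ⟨n, hn, h⟩ := hmax (N ⊔ Submodule.span K {a}).toAddSubgroup
    ⟨_, hN.sup (Submodule.fg_span_singleton a), rfl⟩ (fun b hb => Submodule.mem_sup_left hb)
  have h' : n • a ∈ N := h a (Submodule.mem_sup_right (Submodule.mem_span_singleton_self a))
  rw [← Nat.cast_smul_eq_nsmul K] at h'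
  exact (N.smul_mem_iff (Nat.cast_ne_zero.2 hn.ne')).1 h'

theorem isDef_mem_submodule [CharZero K] (hsmul : IsDefMap L M (fun p : K × V => p.1 • p.2))
    (N : Submodule K V) : IsDef L M (· ∈ N) :=
  haveI := moduleFinite_of_definable hsmul
  isDef_mem_of_fg hsmul N (IsNoetherian.noetherian N)

/-- The graph of a coordinate function is defined by the kernel of this function. -/
theorem isDefMap_repr [CharZero K] (hsmul : IsDefMap L M (fun p : K × V => p.1 • p.2))
    {ι : Type*} (b : Module.Basis ι K V) (i : ι) : IsDefMap L M (fun a => b.repr a i) := by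
  have h := (isDef_mem_submodule hsmul (LinearMap.ker (b.coord i))).comp
    (f := fun q : V × K => q.1 - q.2 • b i)
    (IsDefMap.sub (by fun_prop) (hsmul.comp (f := fun q : V × K => (q.2, b i)) (by fun_prop)))
  refine (congrArg (IsDef L M) (funext fun q => propext ?_)).mp h
  rw [LinearMap.mem_ker, map_sub, map_smul, sub_eq_zero]
  simp

/-- A definable action by linear maps of a definable vector space is given by matrices
with definable entries. -/
theorem exists_matrix {A : Type*} [AddCommGroup A] [Coding L M A] [CharZero K]
    {ρ : A →+ AddMonoid.End V} (hρ : IsDefMap L M (fun p : A × V => ρ p.1 p.2))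
    (hsmul : IsDefMap L M (fun p : K × V => p.1 • p.2))
    (hlin : ∀ (k : K) (x : A) (a : V), ρ x (k • a) = k • ρ x a) :
    ∃ (n : ℕ) (φ : A →+ Matrix (Fin n) (Fin n) K),
      (∀ x, φ x = 0 ↔ ∀ a, ρ x a = 0) ∧
      (∀ x y z, (∀ a, ρ z a = ρ x (ρ y a) - ρ y (ρ x a)) → φ z = φ x * φ y - φ y * φ x) ∧
      ∀ i j, IsDefMap L M (fun x => φ x i j) := by
  have := moduleFinite_of_definable hsmul
  let b := Module.finBasis K V
  let ℓ : A →+ (V →ₗ[K] V) :=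
    { toFun := fun x => { toFun := ρ x, map_add' := map_add _, map_smul' := fun k a => hlin k x a }
      map_zero' := by ext a; simp
      map_add' := fun x y => LinearMap.ext fun a => DFunLike.congr_fun (map_add ρ x y) a }
  refine ⟨_, (LinearMap.toMatrix b b).toAddEquiv.toAddMonoidHom.comp ℓ, fun x => ?_,
    fun x y z h => ?_, fun i j => ?_⟩
  · have : LinearMap.toMatrix b b (ℓ x) = 0 ↔ ∀ a, ρ x a = 0 := by
      rw [map_eq_zero_iff _ (LinearMap.toMatrix b b).injective, LinearMap.ext_iff]
      rfl
    exact this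
  · have h' : ℓ z = ℓ x * ℓ y - ℓ y * ℓ x := LinearMap.ext h
    change LinearMap.toMatrix b b (ℓ z) = LinearMap.toMatrix b b (ℓ x) *
      LinearMap.toMatrix b b (ℓ y) - LinearMap.toMatrix b b (ℓ y) * LinearMap.toMatrix b b (ℓ x)
    rw [h', map_sub, LinearMap.toMatrix_mul, LinearMap.toMatrix_mul]
  · have : IsDefMap L M (fun x => b.repr (ρ x (b j)) i) :=
      (isDefMap_repr hsmul b i).comp (hρ.comp (f := fun x => (x, b j)) (by fun_prop))
    refine (congrArg (IsDefMap L M) (funext fun x => ?_)).mp this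
    exact (LinearMap.toMatrix_apply b b (ℓ x) i j).symm

end DefModule

end FinDimLie

namespace FinDimLie

/-! ### Interpretations and codings -/

section Interpretation

variable {L : FirstOrder.Language.{u, v}} {M : Type w} [L.Structure M] {X Y Z : Type*}

/-- An interpretation, seen as a coding. -/
@[reducible] def Interpretation.toCoding (I : Interpretation L M X) : Coding L M X where
  ι := Fin I.arity
  finite := inferInstance
  Code := I.Code
  unique := by
    rintro c x y ⟨h, rfl⟩ ⟨h', rfl⟩
    rfl
  exists_code x := by
    obtain ⟨⟨c, hc⟩, h⟩ := Quotient.exists_rep (I.equiv.symm x)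
    exact ⟨c, hc, (congrArg I.equiv h).trans (I.equiv.apply_symm_apply x)⟩
  definable := by
    refine (congrArg _ (Set.ext fun p => ?_)).mp I.carrier.definable
    constructor
    · intro h
      have h' := I.carrier.symm h
      exact ⟨_, ⟨I.carrier.trans h h', rfl⟩, I.carrier.trans h' h,
        congrArg I.equiv ((I.carrier.elem_eq_iff _ _).2 h')⟩
    · rintro ⟨x, ⟨h, e⟩, h', e'⟩
      exact (I.carrier.elem_eq_iff h h').1 (I.equiv.injective (e.trans e'.symm))

/-- The interpretation `I` and the coding `C` have the same codes, up to the indexing of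
the tuples. -/
def Interpretation.Compatible (I : Interpretation L M X) (C : Coding L M X) : Prop :=
  ∃ e : C.ι ≃ Fin I.arity, ∀ c x, I.Code c x ↔ C.Code (c ∘ e) x

theorem Interpretation.compatible_toCoding (I : Interpretation L M X) :
    I.Compatible I.toCoding :=
  ⟨Equiv.refl _, fun _ _ => Iff.rfl⟩

theorem Coding.exists_interpretation (C : Coding L M X) :
    ∃ I : Interpretation L M X, I.Compatible C := by
  obtain ⟨a, ⟨e⟩⟩ := Finite.exists_equiv_fin C.ι
  let S : InterpSet L M a :=
    { rel := fun c d => ∃ x, C.Code (c ∘ e) x ∧ C.Code (d ∘ e) x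
      symm := fun ⟨x, h, h'⟩ => ⟨x, h', h⟩
      trans := by
        rintro c d d' ⟨x, h, h'⟩ ⟨y, h₁, h₂⟩
        obtain rfl := C.unique h' h₁
        exact ⟨x, h, h₂⟩
      definable := C.definable.preimage_comp (Sum.map e e) }
  have hS : ∀ c : {c : Fin a → M // S.dom c}, ∃ x, C.Code (c.1 ∘ e) x := fun c =>
    ⟨c.2.choose, c.2.choose_spec.1⟩
  choose f hf using hS
  have hfS : ∀ c d : {c : Fin a → M // S.dom c}, f c = f d ↔ S.rel c.1 d.1 := by
    intro c d
    constructor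
    · intro h
      exact ⟨f c, hf c, h ▸ hf d⟩
    · rintro ⟨x, h, h'⟩
      rw [C.unique (hf c) h, C.unique (hf d) h']
  let g : S.Elem → X := Quotient.lift f fun c d h => (hfS c d).2 h
  have hg : Function.Bijective g := by
    constructor
    · intro c d h
      induction c using Quotient.inductionOn with | _ c
      induction d using Quotient.inductionOn with | _ d
      exact Quotient.sound ((hfS c d).1 h)
    · intro x
      obtain ⟨c, hc⟩ := C.exists_code x
      have hc' : C.Code ((c ∘ e.symm) ∘ e) x := by simpa [Function.comp_assoc] using hc
      exact ⟨S.elem (c ∘ e.symm) ⟨x, hc', hc'⟩, C.unique (hf ⟨c ∘ e.symm, _⟩) hc'⟩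
  refine ⟨⟨a, S, Equiv.ofBijective g hg⟩, e, fun c x => ?_⟩
  constructor
  · rintro ⟨h, rfl⟩
    exact hf ⟨c, h⟩
  · exact fun h => ⟨⟨x, h, h⟩, C.unique (hf ⟨c, _⟩) h⟩

theorem definable_congr_equiv {α β : Type*} (e : α ≃ β) {s : Set (α → M)} {t : Set (β → M)}
    (h : ∀ x, x ∈ t ↔ x ∘ e ∈ s) :
    (Set.univ : Set M).Definable L t ↔ (Set.univ : Set M).Definable L s := by
  constructor
  · intro ht
    refine (congrArg _ (Set.ext fun x => ?_)).mp (ht.preimage_comp e.symm)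
    rw [Set.mem_preimage, h]
    simp [Function.comp_assoc]
  · intro hs
    exact (congrArg _ (Set.ext fun x => (h x).symm)).mp (hs.preimage_comp e)

variable {I : Interpretation L M X} {J : Interpretation L M Y} {K : Interpretation L M Z}

theorem Interpretation.Compatible.definableSet_iff [C : Coding L M X] (h : I.Compatible C)
    {S : Set X} : I.DefinableSet S ↔ IsDef L M (· ∈ S) := by
  obtain ⟨e, h⟩ := h
  refine definable_congr_equiv e fun c => ?_
  simp only [Set.mem_ofPred_eq, h]

theorem Interpretation.Compatible.definableRel₂_iff [C : Coding L M X] [D : Coding L M Y]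
    (h : I.Compatible C) (h' : J.Compatible D) {R : X → Y → Prop} :
    I.DefinableRel₂ J R ↔ IsDef L M (fun q : X × Y => R q.1 q.2) := by
  obtain ⟨e, h⟩ := h
  obtain ⟨e', h'⟩ := h'
  refine definable_congr_equiv (Equiv.sumCongr e e') fun c => ?_
  simp only [Set.mem_ofPred_eq, h, h', Prod.exists]
  exact exists_congr fun a => exists_congr fun b => (and_assoc (c := R a b)).symm

theorem Interpretation.Compatible.definableRel₃_iff [C : Coding L M X] [D : Coding L M Y]
    [E : Coding L M Z] (h : I.Compatible C) (h' : J.Compatible D) (h'' : K.Compatible E)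
    {R : X → Y → Z → Prop} :
    I.DefinableRel₃ J K R ↔ IsDef L M (fun q : (X × Y) × Z => R q.1.1 q.1.2 q.2) := by
  obtain ⟨e, h⟩ := h
  obtain ⟨e', h'⟩ := h'
  obtain ⟨e'', h''⟩ := h''
  refine definable_congr_equiv (Equiv.sumCongr (Equiv.sumCongr e e') e'') fun c => ?_
  simp only [Set.mem_ofPred_eq, h, h', h'', Prod.exists]
  refine exists_congr fun a => exists_congr fun b => exists_congr fun d => ?_
  rw [← and_assoc, ← and_assoc]
  rfl

theorem Interpretation.Compatible.definableMap_iff [C : Coding L M X] [D : Coding L M Y]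
    (h : I.Compatible C) (h' : J.Compatible D) {f : X → Y} :
    I.DefinableMap J f ↔ IsDefMap L M f :=
  h.definableRel₂_iff h'

theorem Interpretation.Compatible.definableMap₂_iff [C : Coding L M X] [D : Coding L M Y]
    [E : Coding L M Z] (h : I.Compatible C) (h' : J.Compatible D) (h'' : K.Compatible E)
    {f : X → Y → Z} : I.DefinableMap₂ J K f ↔ IsDefMap L M (fun q : X × Y => f q.1 q.2) :=
  h.definableRel₃_iff h' h''

theorem Interpretation.Compatible.isDefinableField {F : Type*} [Field F] [C : Coding L M F]
    [DefField L M F] {I : Interpretation L M F} (h : I.Compatible C) : I.IsDefinableField :=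
  ⟨(h.definableMap₂_iff h h).2 DefAddGroup.add, (h.definableMap₂_iff h h).2 DefField.mul⟩

end Interpretation

/-! ### Definable Lie rings of matrices -/

section Matrix

variable {L : FirstOrder.Language.{u, v}} {M : Type w} [L.Structure M]

theorem IsDef.forall_finite {X ι : Type*} [Coding L M X] [Finite ι] {p : ι → X → Prop}
    (h : ∀ i, IsDef L M (p i)) : IsDef L M (fun x => ∀ i, p i x) := by
  refine IsDef.of_definable ((IsDef.true (X := X)).inter (Set.definable_iInter_of_finite h))
    fun c => ?_
  constructor
  · rintro ⟨⟨x, hx, -⟩, h⟩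
    refine ⟨x, hx, fun i => ?_⟩
    obtain ⟨y, hy, h⟩ := Set.mem_iInter.1 h i
    rwa [Coding.unique hx hy]
  · rintro ⟨x, hx, h⟩
    exact ⟨⟨x, hx, trivial⟩, Set.mem_iInter.2 fun i => ⟨x, hx, h i⟩⟩

theorem IsDefMap.of_comp_surjective {X Y Z : Type*} [Coding L M X] [Coding L M Y] [Coding L M Z]
    {f : X → Y} {g : Y → Z} (hf : IsDefMap L M f) (hf' : Function.Surjective f)
    (h : IsDefMap L M (fun x => g (f x))) : IsDefMap L M g := by
  have := IsDef.exists (X := Y × Z) (p := fun q x => f x = q.1 ∧ g (f x) = q.2)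
    (IsDef.and (IsDef.eq (hf.comp IsDefMap.snd) (by fun_prop))
      (IsDef.eq (h.comp IsDefMap.snd) (by fun_prop)))
  refine (congrArg (IsDef L M) (funext fun q => propext ?_)).mp this
  constructor
  · rintro ⟨x, h₁, h₂⟩
    rwa [h₁] at h₂
  · intro h
    obtain ⟨x, hx⟩ := hf' q.1
    exact ⟨x, hx, by rw [hx, h]⟩

variable {K : Type w} [Field K] [Coding L M K] [DefField L M K] [CharZero K]
  [Nonempty M] [FinDimModel L M]

/-- A definable subring `R` of a definable field of characteristic zero is a field. By the
descending chain condition each `r R` with `r ≠ 0` contains a multiple of `R`, and by uniformity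
it contains `N R` for an `N` that does not depend on `r`; then `N r R` contains `N`. -/
theorem inv_mem_of_isDef (R : Subring K) (hR : IsDef L M (· ∈ R)) {r : K} (hr : r ∈ R) :
    r⁻¹ ∈ R := by
  have hW : IsDef L M (fun q : K × K =>
      q.2 ∈ R.toAddSubgroup.map (AddMonoidHom.mulLeft q.1)) := by
    simp only [AddSubgroup.mem_map]
    exact IsDef.exists (p := fun (q : K × K) s => s ∈ R ∧ q.1 * s = q.2)
      ((hR.comp IsDefMap.snd).and (IsDef.eq (by fun_prop) (by fun_prop)))
  have hle : ∀ r ∈ R, r ≠ 0 →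
      AlmostLE R.toAddSubgroup (R.toAddSubgroup.map (AddMonoidHom.mulLeft r)) := by
    intro r hr h0
    obtain ⟨_, ⟨i, rfl⟩, hmin⟩ := exists_minimal_almostLE L M
      (fun H : AddSubgroup K => ∃ i : ℕ, H = R.toAddSubgroup.map (AddMonoidHom.mulLeft (r ^ i)))
      ⟨_, 0, rfl⟩ (by
        rintro _ ⟨i, rfl⟩
        exact hW.comp (f := fun k => (r ^ i, k)) (by fun_prop))
    obtain ⟨c, hc, h⟩ := hmin (R.toAddSubgroup.map (AddMonoidHom.mulLeft (r ^ (i + 1))))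
      ⟨_, rfl⟩ (by
        rintro _ ⟨s, hs, rfl⟩
        exact ⟨r * s, R.mul_mem hr hs, by simp [pow_succ, mul_assoc]⟩)
    refine ⟨c, hc, fun s hs => ?_⟩
    obtain ⟨t, ht, e⟩ := h (r ^ i * s) ⟨s, hs, rfl⟩
    refine ⟨t, ht, mul_left_cancel₀ (pow_ne_zero i h0) ?_⟩
    change r ^ i * (r * t) = r ^ i * (c • s)
    rw [mul_smul_comm, ← mul_assoc, ← pow_succ]
    exact e
  obtain ⟨N, hN, h⟩ := exists_nsmul_mem_of_almostLE
    (W := fun k : K => R.toAddSubgroup.map (AddMonoidHom.mulLeft k)) hW (S := R.toAddSubgroup) hR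
  by_cases h0 : r = 0
  · rw [h0, inv_zero]
    exact zero_mem R
  · have hN0 : (N : K) ≠ 0 := Nat.cast_ne_zero.2 hN.ne'
    obtain ⟨s, hs, e⟩ := h (N * r) (hle _ (mul_mem (natCast_mem R N) hr) (mul_ne_zero hN0 h0))
      1 (one_mem R)
    have e' : (N : K) * (r * s) = N * 1 := by
      simpa [mul_assoc, nsmul_eq_mul] using e
    rw [inv_eq_of_mul_eq_one_right (mul_left_cancel₀ hN0 e')]
    exact hs

/-- A definable Lie ring of matrices is a finite-dimensional Lie algebra over the definable
subfield of the scalars that preserve it. -/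
theorem exists_lieAlgebra_of_matrix {𝔥 : Type*} [LieRing 𝔥] [Coding L M 𝔥] [DefAddGroup L M 𝔥]
    {n : ℕ} (φ : 𝔥 →+ Matrix (Fin n) (Fin n) K) (hφ : Function.Injective φ)
    (hlie : ∀ x y, φ ⁅x, y⁆ = φ x * φ y - φ y * φ x)
    (hdef : ∀ i j, IsDefMap L M (fun x => φ x i j)) :
    ∃ (R : Type w) (_ : Field R) (_ : Coding L M R) (_ : LieAlgebra R 𝔥), CharZero R ∧
      DefField L M R ∧ IsDefMap L M (fun p : R × 𝔥 => p.1 • p.2) := by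
  let R₀ : Subring K :=
    { carrier := {k | ∀ x, ∃ y, φ y = k • φ x}
      zero_mem' := fun x => ⟨0, by simp⟩
      one_mem' := fun x => ⟨x, by simp⟩
      add_mem' := by
        intro k l hk hl x
        obtain ⟨y, hy⟩ := hk x
        obtain ⟨z, hz⟩ := hl x
        exact ⟨y + z, by rw [map_add, hy, hz, add_smul]⟩
      neg_mem' := by
        intro k hk x
        obtain ⟨y, hy⟩ := hk x
        exact ⟨-y, by rw [map_neg, hy, neg_smul]⟩
      mul_mem' := by
        intro k l hk hl x
        obtain ⟨y, hy⟩ := hl x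
        obtain ⟨z, hz⟩ := hk y
        exact ⟨z, by rw [hz, hy, mul_smul]⟩ }
  have heq : IsDef L M (fun q : (K × 𝔥) × 𝔥 => φ q.2 = q.1.1 • φ q.1.2) := by
    simp only [← Matrix.ext_iff, Matrix.smul_apply, smul_eq_mul]
    refine IsDef.forall_finite fun i => IsDef.forall_finite fun j => IsDef.eq ?_ ?_
    · exact (hdef i j).comp IsDefMap.snd
    · exact IsDefMap.mul (by fun_prop)
        ((hdef i j).comp (f := fun q : (K × 𝔥) × 𝔥 => q.1.2) (by fun_prop))
  have hR₀ : IsDef L M (· ∈ R₀) := IsDef.forall (IsDef.exists heq)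
  let R : Subfield K := { R₀ with inv_mem' := fun _ hr => inv_mem_of_isDef R₀ hR₀ hr }
  have hrange : IsDef L M (· ∈ Set.range (Subtype.val : R → K)) := by
    rw [Subtype.range_val]
    exact hR₀
  let _ : Coding L M R := Coding.ofInjective L M _ Subtype.val_injective hrange
  have hval : IsDefMap L M (Subtype.val : R → K) :=
    Coding.isDefMap_ofInjective _ Subtype.val_injective hrange
  let _ : SMul R 𝔥 := ⟨fun k x => (k.2 x).choose⟩
  have hsmul : ∀ (k : R) (x : 𝔥), φ (k • x) = k • φ x := fun k x => (k.2 x).choose_spec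
  let _ : Module R 𝔥 := hφ.module R φ hsmul
  let _ : LieAlgebra R 𝔥 := { lie_smul := fun k x y => hφ (by
    rw [hlie, hsmul, hsmul, hlie, smul_sub, mul_smul_comm, smul_mul_assoc]) }
  have hadd : DefAddGroup L M R := ⟨IsDefMap.of_comp_injective hval Subtype.val_injective
    (IsDefMap.add (f := fun p : R × R => p.1.1) (g := fun p : R × R => p.2.1)
      (by fun_prop) (by fun_prop))⟩
  refine ⟨R, inferInstance, inferInstance, inferInstance, inferInstance,
    ⟨IsDefMap.of_comp_injective hval Subtype.val_injective
      (IsDefMap.mul (f := fun p : R × R => p.1.1) (g := fun p : R × R => p.2.1)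
        (by fun_prop) (by fun_prop))⟩, ?_⟩
  refine (congrArg (IsDef L M) (funext fun q => propext ?_)).mp
    (heq.comp (f := fun q : (R × 𝔥) × 𝔥 => ((q.1.1.1, q.1.2), q.2)) (by fun_prop))
  constructor
  · intro h
    exact hφ ((hsmul _ _).trans h.symm)
  · rintro h
    rw [← h]
    exact hsmul _ _

/-- The Lie algebra structure of `exists_lieAlgebra_of_matrix` in terms of interpretations, for
the Lie ring seen as a subring of itself. All subspaces are definable. -/
theorem exists_isDefinableLieAlgebra_top {𝔥 : Type*} [LieRing 𝔥] [C : Coding L M 𝔥]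
    [DefAddGroup L M 𝔥] {I : Interpretation L M 𝔥} (hI : I.Compatible C)
    {n : ℕ} (φ : 𝔥 →+ Matrix (Fin n) (Fin n) K) (hφ : Function.Injective φ)
    (hlie : ∀ x y, φ ⁅x, y⁆ = φ x * φ y - φ y * φ x)
    (hdef : ∀ i j, IsDefMap L M (fun x => φ x i j)) :
    ∃ (R : Type w) (_ : Field R) (F : Interpretation L M R)
      (_ : LieAlgebra R (⊤ : LieSubalgebra ℤ 𝔥)), CharZero R ∧ F.IsDefinableLieAlgebra I ⊤ ∧
      ∀ N : Submodule R (⊤ : LieSubalgebra ℤ 𝔥),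
        I.DefinableSet (Subtype.val '' (N : Set (⊤ : LieSubalgebra ℤ 𝔥))) := by
  have hrange : IsDef L M (· ∈ Set.range (Subtype.val : (⊤ : LieSubalgebra ℤ 𝔥) → 𝔥)) := by
    rw [Subtype.range_val]
    exact IsDef.true
  let _ : Coding L M (⊤ : LieSubalgebra ℤ 𝔥) :=
    Coding.ofInjective L M _ Subtype.val_injective hrange
  have hval : IsDefMap L M (Subtype.val : (⊤ : LieSubalgebra ℤ 𝔥) → 𝔥) :=
    Coding.isDefMap_ofInjective _ Subtype.val_injective hrange
  have hmk : IsDefMap L M (fun x : 𝔥 => (⟨x, trivial⟩ : (⊤ : LieSubalgebra ℤ 𝔥))) :=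
    IsDefMap.of_comp_injective hval Subtype.val_injective (by fun_prop)
  have hadd : DefAddGroup L M (⊤ : LieSubalgebra ℤ 𝔥) :=
    ⟨IsDefMap.of_comp_injective hval Subtype.val_injective
      (IsDefMap.add (f := fun p : (⊤ : LieSubalgebra ℤ 𝔥) × (⊤ : LieSubalgebra ℤ 𝔥) => p.1.1)
        (g := fun p => p.2.1) (by fun_prop) (by fun_prop))⟩
  obtain ⟨R, _, C', _, hchar, _, hsmul⟩ := exists_lieAlgebra_of_matrix
    (𝔥 := (⊤ : LieSubalgebra ℤ 𝔥)) (φ.comp (⊤ : LieSubalgebra ℤ 𝔥).subtype.toAddMonoidHom)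
    (hφ.comp Subtype.val_injective) (fun x y => hlie x.1 y.1) fun i j => (hdef i j).comp hval
  obtain ⟨F, hF⟩ := C'.exists_interpretation
  refine ⟨R, _, F, _, hchar, ⟨hF.isDefinableField, moduleFinite_of_definable hsmul, ?_⟩,
    fun N => ?_⟩
  · rw [hF.definableRel₃_iff hI hI]
    have h : IsDef L M (fun q : (R × 𝔥) × 𝔥 =>
        (q.1.1 • (⟨q.1.2, trivial⟩ : (⊤ : LieSubalgebra ℤ 𝔥))).1 = q.2) := by
      refine IsDef.eq (hval.comp (hsmul.comp (f := fun q : (R × 𝔥) × 𝔥 =>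
        (q.1.1, (⟨q.1.2, trivial⟩ : (⊤ : LieSubalgebra ℤ 𝔥)))) ?_)) (by fun_prop)
      exact IsDefMap.prodMk (by fun_prop)
        (hmk.comp (f := fun q : (R × 𝔥) × 𝔥 => q.1.2) (by fun_prop))
    refine (congrArg (IsDef L M) (funext fun q => propext ?_)).mp h
    exact ⟨fun h => ⟨trivial, h⟩, fun ⟨_, h⟩ => h⟩
  · rw [hI.definableSet_iff]
    exact (isDef_mem_submodule hsmul N).image hval

end Matrix

end FinDimLie

namespace FinDimLie

/-! ### Definable modules -/

section LieModule

variable {L : FirstOrder.Language.{u, v}} {M : Type w} [L.Structure M] [Nonempty M]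
  [FinDimModel L M]

/-- The action of a Lie ring on a module, as an additive map to the endomorphisms. -/
def lieAction (𝔤 V : Type*) [LieRing 𝔤] [AddCommGroup V] [LieRingModule 𝔤 V] :
    𝔤 →+ AddMonoid.End V where
  toFun x := { toFun := fun a => ⁅x, a⁆, map_zero' := lie_zero x, map_add' := lie_add x }
  map_zero' := by ext a; exact zero_lie a
  map_add' x y := by ext a; exact add_lie x y a

theorem eq_zero_of_nsmul_eq_zero {G : Type*} [AddCommGroup G] (h : IsAddTorsionFree G) {n : ℕ}
    (hn : 0 < n) {x : G} (hx : n • x = 0) : x = 0 :=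
  h.nsmul_right_injective hn.ne' (by simpa using hx)

/-- If some positive integer annihilates the action of a torsion-free definable Lie ring, the
action is almost trivial: the multiples by that integer form a subgroup of finite index. -/
theorem isAlmostTrivial_of_nsmul_lie_eq_zero {𝔤 V : Type*} [LieRing 𝔤] [AddCommGroup V]
    [LieRingModule 𝔤 V] [Coding L M 𝔤] [DefAddGroup L M 𝔤] (htf : IsAddTorsionFree 𝔤) {n : ℕ}
    (hn : 0 < n) (h : ∀ (x : 𝔤) (a : V), n • ⁅x, a⁆ = 0) : IsAlmostTrivial 𝔤 V := by
  have hfin := finiteIndex_range_of_injective (L := L) (M := M)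
    (nsmulAddMonoidHom n : AddMonoid.End 𝔤) (IsDefMap.nsmul n IsDefMap.id)
    (htf.nsmul_right_injective hn.ne')
  have hle : AddMonoidHom.range (nsmulAddMonoidHom n : 𝔤 →+ 𝔤) ≤
      (almostCentralizer 𝔤 V).toSubmodule.toAddSubgroup := by
    rintro _ ⟨x, rfl⟩
    have : centralizerIn V (n • x) = ⊤ := eq_top_iff.2 fun a _ => by
      change ⁅n • x, a⁆ = 0
      rw [nsmul_lie, h]
    change (centralizerIn V (n • x)).FiniteIndex
    rw [this]
    infer_instance
  have := AddSubgroup.finiteIndex_of_le hle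
  exact AddSubgroup.finite_quotient_of_finiteIndex
    (H := (almostCentralizer 𝔤 V).toSubmodule.toAddSubgroup)

/-- A minimal module that is not almost trivial gives a definable representation by matrices over
a definable field whose kernel is the almost centraliser: the action on a divisible torsion-free
irreducible submodule, which has finite index by minimality. -/
theorem exists_representation {𝔤 V : Type*} [LieRing 𝔤] [AddCommGroup V] [LieRingModule 𝔤 V]
    [Coding L M 𝔤] [DefAddGroup L M 𝔤] [Coding L M V] [DefAddGroup L M V]
    (hlie : IsDefMap L M (fun p : 𝔤 × V => ⁅p.1, p.2⁆)) (htf : IsAddTorsionFree 𝔤)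
    (hmin : ∀ W : AddSubgroup V, IsDef L M (· ∈ W) → (∀ x : 𝔤, ∀ a ∈ W, ⁅x, a⁆ ∈ W) →
      (W : Set V).Finite ∨ W.FiniteIndex) (hne : ¬ IsAlmostTrivial 𝔤 V) :
    ∃ (n : ℕ) (K : Type w) (_ : Field K) (_ : Coding L M K)
      (φ : 𝔤 →+ Matrix (Fin n) (Fin n) K), CharZero K ∧ DefField L M K ∧
      (∀ x, φ x = 0 ↔ x ∈ almostCentralizer 𝔤 V) ∧
      (∀ x y, φ ⁅x, y⁆ = φ x * φ y - φ y * φ x) ∧ ∀ i j, IsDefMap L M (fun x => φ x i j) := by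
  have hne' : ∀ n : ℕ, 0 < n → ∃ (x : 𝔤) (a : V), n • ⁅x, a⁆ ≠ 0 := by
    intro n hn
    by_contra! h
    exact hne (isAlmostTrivial_of_nsmul_lie_eq_zero (L := L) (M := M) htf hn h)
  obtain ⟨U, hUdef, hUinv, hU0, hUdiv, hUtf, hUirr⟩ :=
    exists_irreducible_submodule (ρ := lieAction 𝔤 V) hlie
      (fun W h h' => (hmin W h h').imp almostLE_bot_of_finite almostLE_of_finiteIndex) hne'
  have hUfin : U.FiniteIndex := by
    refine (hmin U hUdef hUinv).resolve_left fun h => hU0 ?_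
    obtain ⟨c, hc, h⟩ := almostLE_bot_of_finite h
    exact (AddSubgroup.eq_bot_iff_forall _).2 fun a ha => hUtf c hc a ha (h a ha)
  have hrange : IsDef L M (· ∈ Set.range (Subtype.val : U → V)) := by
    rw [Subtype.range_val]
    exact hUdef
  let _ : Coding L M U := Coding.ofInjective L M _ Subtype.val_injective hrange
  have hval : IsDefMap L M (Subtype.val : U → V) :=
    Coding.isDefMap_ofInjective _ Subtype.val_injective hrange
  have : DefAddGroup L M U := ⟨IsDefMap.of_comp_injective hval Subtype.val_injective
    (IsDefMap.add (f := fun p : U × U => p.1.1) (g := fun p => p.2.1)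
      (by fun_prop) (by fun_prop))⟩
  let ρ : 𝔤 →+ AddMonoid.End U :=
    { toFun := fun x =>
        { toFun := fun a => ⟨⁅x, a.1⁆, hUinv x a.1 a.2⟩
          map_zero' := Subtype.ext (lie_zero x)
          map_add' := fun a b => Subtype.ext (lie_add x a.1 b.1) }
      map_zero' := by ext a; exact zero_lie a.1
      map_add' := fun x y => by ext a; exact add_lie x y a.1 }
  have hρ : IsDefMap L M (fun p : 𝔤 × U => ρ p.1 p.2) :=
    IsDefMap.of_comp_injective hval Subtype.val_injective
      (hlie.comp (f := fun p : 𝔤 × U => (p.1, p.2.1)) (by fun_prop))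
  have htfU : ∀ n : ℕ, 0 < n → ∀ a : U, n • a = 0 → a = 0 := fun n hn a h =>
    Subtype.ext (hUtf n hn a a.2 (congrArg Subtype.val h))
  -- As `U` contains `c V`, the action on it is not trivial.
  obtain ⟨c, hc, hcU⟩ := almostLE_of_finiteIndex hUfin
  obtain ⟨K, _, _, _, _, hsmul, hlin⟩ := exists_field hρ htfU
    (by
      rintro W hW ⟨n, hn, h⟩
      have hWU : W.map U.subtype ≤ U := by
        rintro _ ⟨a, -, rfl⟩
        exact a.2
      refine (hUirr (W.map U.subtype) hWU (hW.image hval) ⟨n, hn, ?_⟩).imp ?_ ?_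
      · rintro x _ ⟨a, ha, rfl⟩
        exact ⟨_, h x a ha, rfl⟩
      · exact fun h => (AddSubgroup.map_eq_bot_iff_of_injective _ Subtype.val_injective).1 h
      · intro h
        refine eq_top_iff.2 fun a _ => ?_
        obtain ⟨b, hb, e⟩ := h.ge a.2
        rwa [← Subtype.ext e])
    (by
      obtain ⟨x, a, h⟩ := hne' c hc
      refine ⟨x, ⟨c • a, hcU a trivial⟩, fun h' => h ?_⟩
      rw [← lie_nsmul]
      exact congrArg Subtype.val h')
  have : CharZero K := by
    refine charZero_of_inj_zero fun n hn => ?_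
    by_contra h0
    refine hU0 ((AddSubgroup.eq_bot_iff_forall _).2 fun a ha => ?_)
    refine congrArg Subtype.val (htfU n (Nat.pos_of_ne_zero h0) ⟨a, ha⟩ ?_)
    rw [← Nat.cast_smul_eq_nsmul K, hn, zero_smul]
  obtain ⟨n, φ, hker, hbr, hdef⟩ := exists_matrix hρ hsmul hlin
  refine ⟨n, K, _, _, φ, ‹_›, ‹_›, fun x => (hker x).trans ⟨fun h => ?_, fun h => ?_⟩,
    fun x y => hbr x y _ fun a => Subtype.ext (lie_lie x y a.1), hdef⟩
  · have hle : U ≤ centralizerIn V x := fun a ha => congrArg Subtype.val (h ⟨a, ha⟩)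
    exact AddSubgroup.finiteIndex_of_le hle
  · obtain ⟨d, hd, h⟩ := almostLE_of_finiteIndex (H := centralizerIn V x) h
    intro a
    obtain ⟨b, hb, e⟩ := hUdiv d hd a a.2
    refine Subtype.ext ?_
    change ⁅x, a.1⁆ = 0
    rw [← e]
    exact h b trivial

/-- A vector space over a field of characteristic zero is divisible, so it has no proper subgroup
of finite index. -/
theorem eq_top_of_finiteIndex {R X : Type*} [Field R] [CharZero R] [AddCommGroup X] [Module R X]
    {H : AddSubgroup X} (h : H.FiniteIndex) : H = ⊤ := by
  obtain ⟨c, hc, h⟩ := almostLE_of_finiteIndex h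
  refine eq_top_iff.2 fun x _ => ?_
  have := h ((c : R)⁻¹ • x) trivial
  rwa [← Nat.cast_smul_eq_nsmul R, smul_inv_smul₀ (Nat.cast_ne_zero.2 hc.ne')] at this

/-- For a minimal module that is not almost trivial, the quotient by the almost centraliser is a
definable Lie ring of matrices, a Lie algebra, and equal to its connected component. -/
theorem exists_quotient {𝔤 V : Type*} [LieRing 𝔤] [AddCommGroup V] [LieRingModule 𝔤 V]
    {I : Interpretation L M 𝔤} {J : Interpretation L M V} (hmod : I.IsDefinableModule J)
    (htf : IsAddTorsionFree 𝔤) (hmin : J.IsMinimalModule 𝔤) (hne : ¬ IsAlmostTrivial 𝔤 V) :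
    ∃ Q : Interpretation L M (𝔤 ⧸ almostCentralizer 𝔤 V),
      I.DefinableMap Q (fun x => (LieSubmodule.Quotient.mk x : 𝔤 ⧸ almostCentralizer 𝔤 V)) ∧
      (∃ (n : ℕ) (K : Type w) (_ : Field K) (F : Interpretation L M K)
        (φ : (𝔤 ⧸ almostCentralizer 𝔤 V) →+ Matrix (Fin n) (Fin n) K),
        CharZero K ∧ F.IsDefinableField ∧ Function.Injective φ ∧
        (∀ x y, φ ⁅x, y⁆ = φ x * φ y - φ y * φ x) ∧
        ∀ i j, Q.DefinableMap F (fun x => φ x i j)) ∧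
      ∃ 𝔥 : LieSubalgebra ℤ (𝔤 ⧸ almostCentralizer 𝔤 V),
        Q.IsConnectedComponent 𝔥.toSubmodule.toAddSubgroup ∧
        ∃ (R : Type w) (_ : Field R) (F : Interpretation L M R) (_ : LieAlgebra R 𝔥),
          CharZero R ∧ F.IsDefinableLieAlgebra Q 𝔥 := by
  let _ : Coding L M 𝔤 := I.toCoding
  let _ : Coding L M V := J.toCoding
  have hI := I.compatible_toCoding
  have hJ := J.compatible_toCoding
  have : DefAddGroup L M 𝔤 := ⟨(hI.definableMap₂_iff hI hI).1 hmod.1.1⟩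
  have : DefAddGroup L M V := ⟨(hJ.definableMap₂_iff hJ hJ).1 hmod.2.1⟩
  obtain ⟨n, K, _, C, φ, hchar, _, hker, hbr, hdef⟩ := exists_representation
    ((hI.definableMap₂_iff hJ hJ).1 hmod.2.2) htf
    (fun W h h' => hmin W (hJ.definableSet_iff.2 h) h') hne
  let π : 𝔤 → 𝔤 ⧸ almostCentralizer 𝔤 V := LieSubmodule.Quotient.mk
  have hπ : Function.Surjective π := Submodule.Quotient.mk_surjective _
  let ψ : (𝔤 ⧸ almostCentralizer 𝔤 V) →+ Matrix (Fin n) (Fin n) K :=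
    ((almostCentralizer 𝔤 V).toSubmodule.liftQ φ.toIntLinearMap
      fun x hx => (hker x).2 hx).toAddMonoidHom
  have hψ : ∀ x, ψ (π x) = φ x := fun x => rfl
  have hψi : Function.Injective ψ := by
    refine (injective_iff_map_eq_zero ψ).2 fun q hq => ?_
    obtain ⟨x, rfl⟩ := hπ q
    exact (Submodule.Quotient.mk_eq_zero _).2 ((hker x).1 hq)
  have hπdef : IsDef L M (fun p : 𝔤 × 𝔤 => π p.1 = π p.2) := by
    simp only [← hψi.eq_iff, hψ, ← Matrix.ext_iff]
    exact IsDef.forall_finite fun i => IsDef.forall_finite fun j =>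
      IsDef.eq ((hdef i j).comp IsDefMap.fst) ((hdef i j).comp IsDefMap.snd)
  let CQ : Coding L M (𝔤 ⧸ almostCentralizer 𝔤 V) := Coding.ofSurjective L M π hπ hπdef
  have hπmap : IsDefMap L M π := Coding.isDefMap_ofSurjective π hπ hπdef
  have : DefAddGroup L M (𝔤 ⧸ almostCentralizer 𝔤 V) :=
    ⟨IsDefMap.of_comp_surjective (f := fun p : 𝔤 × 𝔤 => (π p.1, π p.2)) (by fun_prop)
      (hπ.prodMap hπ) (hπmap.comp (f := fun p : 𝔤 × 𝔤 => p.1 + p.2) (by fun_prop))⟩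
  have hψbr : ∀ x y, ψ ⁅x, y⁆ = ψ x * ψ y - ψ y * ψ x := by
    intro x y
    obtain ⟨x, rfl⟩ := hπ x
    obtain ⟨y, rfl⟩ := hπ y
    exact hbr x y
  have hψdef : ∀ i j, IsDefMap L M (fun x => ψ x i j) := fun i j =>
    IsDefMap.of_comp_surjective hπmap hπ (hdef i j)
  obtain ⟨Q, hQ⟩ := CQ.exists_interpretation
  obtain ⟨F, hF⟩ := C.exists_interpretation
  refine ⟨Q, (hI.definableMap_iff hQ).2 hπmap, ⟨n, K, _, F, ψ, hchar, hF.isDefinableField, hψi,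
    hψbr, fun i j => (hQ.definableMap_iff hF).2 (hψdef i j)⟩, ⊤, ?_⟩
  obtain ⟨R, _, F', _, hcharR, halg, -⟩ := exists_isDefinableLieAlgebra_top hQ ψ hψi hψbr hψdef
  refine ⟨⟨hQ.definableSet_iff.2 IsDef.true, ?_, fun H' _ hH' => ?_⟩, R, _, F', _, hcharR, halg⟩
  · change (⊤ : AddSubgroup (𝔤 ⧸ almostCentralizer 𝔤 V)).FiniteIndex
    infer_instance
  · let e : (⊤ : LieSubalgebra ℤ (𝔤 ⧸ almostCentralizer 𝔤 V)) →+ 𝔤 ⧸ almostCentralizer 𝔤 V :=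
      (⊤ : LieSubalgebra ℤ (𝔤 ⧸ almostCentralizer 𝔤 V)).subtype.toAddMonoidHom
    have h : H'.comap e = ⊤ := eq_top_of_finiteIndex (R := R)
      ⟨by
        rw [AddSubgroup.index_comap_of_surjective _ fun x => ⟨⟨x, trivial⟩, rfl⟩]
        exact hH'.index_ne_zero⟩
    intro x _
    have : (⟨x, trivial⟩ : (⊤ : LieSubalgebra ℤ (𝔤 ⧸ almostCentralizer 𝔤 V))) ∈ H'.comap e :=
      h ▸ trivial
    exact this

/-- An absolutely simple torsion-free definable Lie ring that is not almost abelian is itself a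
simple Lie algebra: it is minimal as a module over itself, and its almost centre is zero. -/
theorem exists_simple_subring {𝔤 : Type*} [LieRing 𝔤] {I : Interpretation L M 𝔤}
    (hdef : I.IsDefinableLieRing) (htf : IsAddTorsionFree 𝔤) (hsimple : I.IsAbsolutelySimple)
    (hab : ¬ IsAlmostAbelian 𝔤) :
    ∃ 𝔥 : LieSubalgebra ℤ 𝔤, I.DefinableSet (𝔥 : Set 𝔤) ∧
      𝔥.toSubmodule.toAddSubgroup.FiniteIndex ∧
      ∃ (K : Type w) (_ : Field K) (F : Interpretation L M K) (_ : LieAlgebra K 𝔥),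
        CharZero K ∧ F.IsDefinableLieAlgebra I 𝔥 ∧ LieAlgebra.IsSimple K 𝔥 := by
  let _ : Coding L M 𝔤 := I.toCoding
  have hI := I.compatible_toCoding
  have : DefAddGroup L M 𝔤 := ⟨(hI.definableMap₂_iff hI hI).1 hdef.1⟩
  have htop : I.DefinableSet ((⊤ : LieSubalgebra ℤ 𝔤) : Set 𝔤) := hI.definableSet_iff.2 IsDef.true
  have htopfin : (⊤ : LieSubalgebra ℤ 𝔤).toSubmodule.toAddSubgroup.FiniteIndex := by
    change (⊤ : AddSubgroup 𝔤).FiniteIndex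
    infer_instance
  have hmin : ∀ J : AddSubgroup 𝔤, IsDef L M (· ∈ J) → (∀ x : 𝔤, ∀ y ∈ J, ⁅x, y⁆ ∈ J) →
      (J : Set 𝔤).Finite ∨ J.FiniteIndex := by
    intro J hJ hJ'
    refine (hsimple ⊤ htop htopfin J (hI.definableSet_iff.2 hJ) (fun _ _ => trivial)
      fun x _ => hJ' x).imp_right fun h => ⟨?_⟩
    rw [← AddSubgroup.relIndex_top_right]
    exact h.relIndex_ne_zero
  have hbot : ∀ J : AddSubgroup 𝔤, (J : Set 𝔤).Finite → J = ⊥ := by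
    intro J hJ
    obtain ⟨c, hc, h⟩ := almostLE_bot_of_finite hJ
    exact (AddSubgroup.eq_bot_iff_forall _).2 fun x hx => eq_zero_of_nsmul_eq_zero htf hc (h x hx)
  -- As `𝔤` is torsion-free, its almost centre is its centre.
  have hcenter : ∀ x ∈ almostCentralizer 𝔤 𝔤, ∀ y : 𝔤, ⁅x, y⁆ = 0 := by
    intro x hx y
    obtain ⟨c, hc, h⟩ := almostLE_of_finiteIndex (H := centralizerIn 𝔤 x) hx
    have h' : ⁅x, c • y⁆ = 0 := h y trivial
    rw [lie_nsmul] at h'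
    exact eq_zero_of_nsmul_eq_zero htf hc h'
  have hnab : ∃ x y : 𝔤, ⁅x, y⁆ ≠ 0 := by
    by_contra! h
    refine hab (eq_top_iff.2 fun x _ => ?_)
    have : centralizerIn 𝔤 x = ⊤ := eq_top_iff.2 fun y _ => h x y
    change (centralizerIn 𝔤 x).FiniteIndex
    rw [this]
    infer_instance
  have hne : ¬ (almostCentralizer 𝔤 𝔤).toSubmodule.toAddSubgroup.FiniteIndex := by
    intro h
    obtain ⟨c, hc, h⟩ := almostLE_of_finiteIndex h
    obtain ⟨x, y, hxy⟩ := hnab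
    have h' := hcenter (c • x) (h x trivial) y
    rw [nsmul_lie] at h'
    exact hxy (eq_zero_of_nsmul_eq_zero htf hc h')
  obtain ⟨n, K, _, _, φ, hchar, _, hker, hbr, hφdef⟩ := exists_representation (V := 𝔤)
    ((hI.definableMap₂_iff hI hI).1 hdef.2) htf hmin
    (fun h => hne (AddSubgroup.finiteIndex_iff_finite_quotient.2 h))
  have hφ : Function.Injective φ := by
    refine (injective_iff_map_eq_zero φ).2 fun x hx => ?_
    have hC : (almostCentralizer 𝔤 𝔤).toSubmodule.toAddSubgroup = ⊥ := by
      refine hbot _ ((hmin _ ?_ fun x y hy => (almostCentralizer 𝔤 𝔤).lie_mem hy).resolve_right hne)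
      refine (congrArg (IsDef L M) (funext fun x => propext ?_)).mp
        (IsDef.forall_finite fun i => IsDef.forall_finite fun j =>
          (IsDef.eq_const (0 : K)).comp (hφdef i j))
      exact (Matrix.ext_iff (N := 0)).trans (hker x)
    exact (AddSubgroup.eq_bot_iff_forall _).1 hC x ((hker x).1 hx)
  obtain ⟨R, _, F, _, hcharR, halg, hideal⟩ := exists_isDefinableLieAlgebra_top hI φ hφ hbr hφdef
  refine ⟨⊤, htop, htopfin, R, _, F, _, hcharR, halg, ?_, ?_⟩
  · intro J
    let e : (⊤ : LieSubalgebra ℤ 𝔤) →+ 𝔤 := (⊤ : LieSubalgebra ℤ 𝔤).subtype.toAddMonoidHom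
    have he : Function.Surjective e := fun x => ⟨⟨x, trivial⟩, rfl⟩
    have hJ := hmin (J.toSubmodule.toAddSubgroup.map e)
      (hI.definableSet_iff.1 (hideal J.toSubmodule)) (by
        rintro x _ ⟨y, hy, rfl⟩
        exact ⟨⁅(⟨x, trivial⟩ : (⊤ : LieSubalgebra ℤ 𝔤)), y⁆, J.lie_mem hy, rfl⟩)
    refine hJ.imp (fun h => ?_) fun h => ?_
    · refine (LieSubmodule.eq_bot_iff _).2 fun x hx => Subtype.ext ?_
      exact (AddSubgroup.eq_bot_iff_forall _).1 (hbot _ h) _ ⟨x, hx, rfl⟩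
    · have h' : J.toSubmodule.toAddSubgroup = ⊤ := eq_top_of_finiteIndex (R := R) ⟨by
        rw [← AddSubgroup.index_map_eq _ he fun x (hx : e x = 0) => ?_]
        · exact h.index_ne_zero
        · rw [show x = 0 from Subtype.ext hx]
          exact zero_mem _⟩
      refine eq_top_iff.2 fun x _ => ?_
      exact h'.ge (AddSubgroup.mem_top x)
  · rintro ⟨h⟩
    obtain ⟨x, y, hxy⟩ := hnab
    exact hxy (congrArg Subtype.val (h ⟨x, trivial⟩ ⟨y, trivial⟩))

end LieModule

end FinDimLie

theorem mainTheorem3 {L : FirstOrder.Language.{u, v}} (T : L.Theory)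
    (hT : IsFiniteDimensional.{u, v, w} T)
    (M : Type w) [L.Structure M] [T.Model M] [Nonempty M] :
    (∀ (𝔤 V : Type*) [LieRing 𝔤] [AddCommGroup V] [LieRingModule 𝔤 V]
      (I : Interpretation L M 𝔤) (J : Interpretation L M V),
      I.IsDefinableModule J → IsAddTorsionFree 𝔤 → J.IsMinimalModule 𝔤 → ¬ IsAlmostTrivial 𝔤 V →
      ∃ Q : Interpretation L M (𝔤 ⧸ almostCentralizer 𝔤 V),
        I.DefinableMap Q (fun x => (LieSubmodule.Quotient.mk x : 𝔤 ⧸ almostCentralizer 𝔤 V)) ∧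
        (∃ (n : ℕ) (K : Type w) (_ : Field K) (F : Interpretation L M K)
          (φ : (𝔤 ⧸ almostCentralizer 𝔤 V) →+ Matrix (Fin n) (Fin n) K),
          CharZero K ∧ F.IsDefinableField ∧ Function.Injective φ ∧
          (∀ x y, φ ⁅x, y⁆ = φ x * φ y - φ y * φ x) ∧
          ∀ i j, Q.DefinableMap F (fun x => φ x i j)) ∧
        ∃ 𝔥 : LieSubalgebra ℤ (𝔤 ⧸ almostCentralizer 𝔤 V),
          Q.IsConnectedComponent 𝔥.toSubmodule.toAddSubgroup ∧
          ∃ (R : Type w) (_ : Field R) (F : Interpretation L M R) (_ : LieAlgebra R 𝔥),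
            CharZero R ∧ F.IsDefinableLieAlgebra Q 𝔥) ∧
    (∀ (𝔤 : Type*) [LieRing 𝔤] (I : Interpretation L M 𝔤),
      I.IsDefinableLieRing → IsAddTorsionFree 𝔤 → I.IsAbsolutelySimple → ¬ IsAlmostAbelian 𝔤 →
      ∃ 𝔥 : LieSubalgebra ℤ 𝔤, I.DefinableSet (𝔥 : Set 𝔤) ∧
        𝔥.toSubmodule.toAddSubgroup.FiniteIndex ∧
        ∃ (K : Type w) (_ : Field K) (F : Interpretation L M K) (_ : LieAlgebra K 𝔥),
          CharZero K ∧ F.IsDefinableLieAlgebra I 𝔥 ∧ LieAlgebra.IsSimple K 𝔥) := by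
  have hM : FinDimModel.{u, v, w} L M := ⟨T, hT, inferInstance⟩
  refine ⟨?_, ?_⟩
  · intro 𝔤 V _ _ _ I J hmod htf hmin hne
    exact exists_quotient hmod htf hmin hne
  · intro 𝔤 _ I hdef htf hsimple hab
    exact exists_simple_subring hdef htf hsimple hab
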